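/- Let $n$ be a positive integer and let $(\mu;\nu)$ be a bipartition of $n$, i.e. a pair of partitions with $|\mu|+|\nu|=n$. Put $\lambda=\mu+\nu$ (termwise sum), let $t=\lambda_1$ be the number of columns of the diagram of $\lambda$, and let $0<r_0\le r_1\le\cdots\le r_{t-1}$ be the lengths of these columns in increasing order, that is, $r_i=\lambda^{\mathbf t}_{t-i}$. Let $I\subset\{0,\dots,t-1\}$ be the unique subset such that the $r_i$ with $i\in I$ are the column lengths of $\mu$ in non-decreasing order, and such that $r_i=r_{i+1}$ and $i+1\in I$ together imply $i\in I$. Let $U_i=\mathbb C^{r_0+\cdots+r_{i-1}}$ for $0\le i\le t$ (so $U_0=0$ and $U_t=\mathbb C^n$). The enhanced quiver variety $\Lambda_{\mu;\nu}=\Lambda_{(r_i),I}$ is the (reduced) closed subvariety of the affine space $\prod_{i=0}^{t}U_i\times\prod_{i=0}^{t-1}\bigl(\operatorname{Hom}(U_i,U_{i+1})\times\operatorname{Hom}(U_{i+1},U_i)\bigr)$ that consists of the tuples $(u_i,A_i,B_i)$ satisfying $$B_iA_i=A_{i-1}B_{i-1}\ (1\le i\le t-1),\qquad B_iu_{i+1}=u_i\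 (i\in I),\qquad A_iu_i=u_{i+1}\ (i\in\{0,\dots,t-1\}\setminus I).$$ Let $V=\mathbb C^n$ and let $\mathcal N\subset\operatorname{End}(V)$ be the variety of nilpotent endomorphisms. The enhanced nilpotent orbit $\mathcal O_{\mu;\nu}\subset V\times\mathcal N$ is the $GL(V)$-orbit consisting of the pairs $(v,x)$ for which $V$ has a basis $(b_{i,j})_{i\ge 1,\;1\le j\le\mu_i+\nu_i}$ such that $x\,b_{i,1}=0$, $x\,b_{i,j}=b_{i,j-1}$ for $j\ge 2$, and $v=\sum_{i:\,\mu_i>0}b_{i,\mu_i}$. Let $\overline{\mathcal O_{\mu;\nu}}$ be its Zariski closure, with the reduced structure. An affine variety (a possibly reducible Zariski closed subset of an affine space over $\mathbb C$) is called normal if all localizations of its coordinate ring at prime ideals are integrally closed domains. If $\Lambda_{\mu;\nu}=\Lambda_{(r_i),I}$ is normal, then $\overline{\mathcal O_{\mu;\nu}}$ is normal. -/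

import Mathlib

noncomputable section

namespace EnhancedNilpotent

open MvPolynomial

/-! ### Affine varieties over `ℂ` -/

/-- The Zariski closure of a set of points in the affine space `ℂ^σ`. -/
def zariskiClosure {σ : Type} (X : Set (σ → ℂ)) : Set (σ → ℂ) :=
  zeroLocus ℂ (vanishingIdeal ℂ X)

/-- The coordinate ring `ℂ[X]` of a Zariski closed set `X ⊆ ℂ^σ` (with its reduced structure). -/
abbrev CoordinateRing {σ : Type} (X : Set (σ → ℂ)) : Type :=
  MvPolynomial σ ℂ ⧸ vanishingIdeal ℂ X

/-- A (possibly reducible) affine variety is normal if all its local rings are integrally closed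
domains. -/
def IsNormalVariety {σ : Type} (X : Set (σ → ℂ)) : Prop :=
  ∀ (𝔭 : Ideal (CoordinateRing X)) [𝔭.IsPrime],
    IsDomain (Localization.AtPrime 𝔭) ∧ IsIntegrallyClosed (Localization.AtPrime 𝔭)

/-! ### Combinatorics of bipartitions

Partitions are Young diagrams: `μ.rowLen i` is the part `μ_{i+1}`, `μ.colLen j` is the part
`(μᵗ)_{j+1}` of the transpose. -/

/-- The partition `λ = μ + ν` (termwise sum of the parts). -/
def sumDiagram (μ ν : YoungDiagram) : YoungDiagram where
  cells := (Finset.range (max (μ.colLen 0) (ν.colLen 0)) ×ˢ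
    Finset.range (μ.rowLen 0 + ν.rowLen 0)).filter
      fun c => c.2 < μ.rowLen c.1 + ν.rowLen c.1
  isLowerSet := by
    rintro ⟨i, j⟩ ⟨i', j'⟩ ⟨hi, hj⟩ h
    simp only [Finset.coe_filter, Finset.mem_product, Finset.mem_range, Set.mem_ofPred_eq] at h ⊢
    have h1 := μ.rowLen_anti i' i hi
    have h2 := ν.rowLen_anti i' i hi
    simp only at hi hj
    omega

theorem mem_sumDiagram {μ ν : YoungDiagram} {i j : ℕ} :
    (i, j) ∈ sumDiagram μ ν ↔ j < μ.rowLen i + ν.rowLen i := by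
  rw [← YoungDiagram.mem_cells]
  simp only [sumDiagram, Finset.mem_filter, Finset.mem_product, Finset.mem_range]
  refine ⟨fun h => h.2, fun h => ⟨⟨?_, ?_⟩, h⟩⟩
  · rcases Nat.eq_zero_or_pos (μ.rowLen i) with h0 | h0
    · have : 0 < ν.rowLen i := by omega
      rw [← YoungDiagram.mem_iff_lt_rowLen, YoungDiagram.mem_iff_lt_colLen] at this
      omega
    · replace h0 : 0 < μ.rowLen i := h0
      rw [← YoungDiagram.mem_iff_lt_rowLen, YoungDiagram.mem_iff_lt_colLen] at h0
      omega
  · have h1 := μ.rowLen_anti 0 i (Nat.zero_le _)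
    have h2 := ν.rowLen_anti 0 i (Nat.zero_le _)
    omega

theorem rowLen_sumDiagram (μ ν : YoungDiagram) (i : ℕ) :
    (sumDiagram μ ν).rowLen i = μ.rowLen i + ν.rowLen i := by
  refine Nat.le_antisymm ?_ ?_
  · by_contra! h
    rw [← YoungDiagram.mem_iff_lt_rowLen, mem_sumDiagram] at h
    omega
  · by_contra! h
    rw [← mem_sumDiagram, YoungDiagram.mem_iff_lt_rowLen] at h
    omega

/-- The number `t = λ_1` of columns of `λ = μ + ν`. -/
def numCols (μ ν : YoungDiagram) : ℕ := (sumDiagram μ ν).rowLen 0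

/-- The column lengths `r_0 ≤ r_1 ≤ ⋯ ≤ r_{t-1}` of `λ = μ + ν` in increasing order; only the
values at `i < t` are meaningful. -/
def colSeq (μ ν : YoungDiagram) (i : ℕ) : ℕ := (sumDiagram μ ν).colLen (numCols μ ν - 1 - i)

/-- The conditions that determine the index set `I ⊆ {0, …, t-1}`: the `r_i` with `i ∈ I` are the
column lengths of `μ` (with multiplicity; their order is automatic since `r` is monotone), and
`r_i = r_{i+1}`, `i + 1 ∈ I` imply `i ∈ I`. -/
structure IsColSet (μ ν : YoungDiagram) (I : Finset ℕ) : Prop where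
  lt : ∀ i ∈ I, i < numCols μ ν
  lengths : I.val.map (colSeq μ ν) = (Multiset.range (μ.rowLen 0)).map μ.colLen
  tie : ∀ i, colSeq μ ν i = colSeq μ ν (i + 1) → i + 1 ∈ I → i ∈ I

/-- The index set `I`: among the indices `i` with a given value `c = r_i`, the first `m` ones, where
`m` is the number of columns of `μ` of length `c`. By `isColSet_iff` this is the only set that
satisfies `IsColSet`. -/
def colSet (μ ν : YoungDiagram) : Finset ℕ :=
  (Finset.range (numCols μ ν)).filter fun i =>
    ((Finset.range i).filter fun j => colSeq μ ν j = colSeq μ ν i).card <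
      ((Finset.range (μ.rowLen 0)).filter fun j => μ.colLen j = colSeq μ ν i).card

theorem card_filter_first (P : ℕ → Prop) [DecidablePred P] (m t : ℕ) :
    ((Finset.range t).filter fun i => P i ∧ ((Finset.range i).filter P).card < m).card =
      min m ((Finset.range t).filter P).card := by
  induction t with
  | zero => simp
  | succ t ih =>
    rw [Finset.range_add_one, Finset.filter_insert, Finset.filter_insert]
    by_cases hP : P t
    · by_cases hm : ((Finset.range t).filter P).card < m
      · simp only [hP, hm, and_self, if_true]
        rw [Finset.card_insert_of_notMem (by simp), Finset.card_insert_of_notMem (by simp), ih]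
        omega
      · simp only [hP, hm, and_false, if_true, if_false]
        rw [Finset.card_insert_of_notMem (by simp), ih]
        omega
    · simp only [hP, false_and, if_false]
      exact ih

theorem card_cols (μ : YoungDiagram) (c : ℕ) :
    ((Finset.range (μ.rowLen 0)).filter fun j => μ.colLen j = c + 1).card =
      μ.rowLen c - μ.rowLen (c + 1) := by
  have : ((Finset.range (μ.rowLen 0)).filter fun j => μ.colLen j = c + 1) =
      Finset.range (μ.rowLen c) \ Finset.range (μ.rowLen (c + 1)) := by
    ext j
    simp only [Finset.mem_filter, Finset.mem_range, Finset.mem_sdiff,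
      ← YoungDiagram.mem_iff_lt_rowLen, YoungDiagram.mem_iff_lt_colLen]
    omega
  rw [this, Finset.card_sdiff_of_subset, Finset.card_range, Finset.card_range]
  exact Finset.range_subset_range.2 (μ.rowLen_anti _ _ (Nat.le_succ _))

theorem card_cols_zero (μ : YoungDiagram) :
    ((Finset.range (μ.rowLen 0)).filter fun j => μ.colLen j = 0).card = 0 := by
  rw [Finset.card_eq_zero, Finset.filter_eq_empty_iff]
  intro j hj
  rw [Finset.mem_range, ← YoungDiagram.mem_iff_lt_rowLen, YoungDiagram.mem_iff_lt_colLen] at hj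
  omega

theorem card_cols_le (μ ν : YoungDiagram) (c : ℕ) :
    ((Finset.range (μ.rowLen 0)).filter fun j => μ.colLen j = c).card ≤
      ((Finset.range (numCols μ ν)).filter fun i => colSeq μ ν i = c).card := by
  have key : ((Finset.range (numCols μ ν)).filter fun i => colSeq μ ν i = c).card =
      ((Finset.range ((sumDiagram μ ν).rowLen 0)).filter
        fun j => (sumDiagram μ ν).colLen j = c).card := by
    refine Finset.card_bij' (fun i _ => numCols μ ν - 1 - i) (fun i _ => numCols μ ν - 1 - i)
      ?_ ?_ ?_ ?_
    · intro i hi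
      obtain ⟨h1, h2⟩ := Finset.mem_filter.1 hi
      rw [Finset.mem_range] at h1
      exact Finset.mem_filter.2 ⟨Finset.mem_range.2 (by change _ < numCols μ ν; omega), h2⟩
    · intro i hi
      obtain ⟨h1, h2⟩ := Finset.mem_filter.1 hi
      replace h1 : i < numCols μ ν := Finset.mem_range.1 h1
      refine Finset.mem_filter.2 ⟨Finset.mem_range.2 (by omega), ?_⟩
      change (sumDiagram μ ν).colLen (numCols μ ν - 1 - (numCols μ ν - 1 - i)) = c
      rw [show numCols μ ν - 1 - (numCols μ ν - 1 - i) = i by omega]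
      exact h2
    · intro i hi
      simp only [Finset.mem_filter, Finset.mem_range] at hi
      omega
    · intro i hi
      simp only [Finset.mem_filter, Finset.mem_range] at hi
      have h1 : i < numCols μ ν := hi.1
      omega
  rw [key]
  cases c with
  | zero => rw [card_cols_zero]; exact Nat.zero_le _
  | succ c =>
    rw [card_cols, card_cols, rowLen_sumDiagram, rowLen_sumDiagram]
    have h1 := μ.rowLen_anti c (c + 1) (Nat.le_succ _)
    have h2 := ν.rowLen_anti c (c + 1) (Nat.le_succ _)
    omega

theorem colSeq_mono (μ ν : YoungDiagram) : Monotone (colSeq μ ν) := fun i j h =>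
  (sumDiagram μ ν).colLen_anti _ _ (by omega)

theorem isColSet_colSet (μ ν : YoungDiagram) : IsColSet μ ν (colSet μ ν) where
  lt i hi := by simpa using (Finset.mem_filter.1 hi).1
  lengths := by
    ext c
    rw [Multiset.count_map, Multiset.count_map]
    have h1 := card_filter_first (fun i => colSeq μ ν i = c)
      ((Finset.range (μ.rowLen 0)).filter fun j => μ.colLen j = c).card (numCols μ ν)
    rw [min_eq_left (card_cols_le μ ν c)] at h1
    have h2 : ((colSet μ ν).filter fun i => c = colSeq μ ν i).card =
        ((Finset.range (μ.rowLen 0)).filter fun j => c = μ.colLen j).card := by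
      simp only [eq_comm (a := c)]
      rw [← h1, colSet, Finset.filter_filter]
      congr 1
      ext i
      simp only [Finset.mem_filter]
      constructor
      · rintro ⟨hi, hlt, rfl⟩
        exact ⟨hi, rfl, hlt⟩
      · rintro ⟨hi, rfl, hlt⟩
        exact ⟨hi, hlt, rfl⟩
    exact h2
  tie i h hi := by
    simp only [colSet, Finset.mem_filter, Finset.mem_range] at hi ⊢
    rw [← h] at hi
    refine ⟨by omega, lt_of_le_of_lt (Finset.card_le_card ?_) hi.2⟩
    exact Finset.filter_subset_filter _ (Finset.range_subset_range.2 (Nat.le_succ _))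

theorem isColSet_iff (μ ν : YoungDiagram) (I : Finset ℕ) : IsColSet μ ν I ↔ I = colSet μ ν := by
  refine ⟨fun h => ?_, fun h => h ▸ isColSet_colSet μ ν⟩
  have down : ∀ k i, colSeq μ ν i = colSeq μ ν (i + k) → i + k ∈ I → i ∈ I := by
    intro k
    induction k with
    | zero => intro i _ hi; exact hi
    | succ k ih =>
      intro i e hi
      have m1 := colSeq_mono μ ν (show i ≤ i + k by omega)
      have m2 := colSeq_mono μ ν (show i + k ≤ i + k + 1 by omega)
      rw [← add_assoc] at e hi
      exact ih i (by omega) (h.tie _ (by omega) hi)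
  have card : ∀ c, (I.filter fun i => colSeq μ ν i = c).card =
      ((Finset.range (μ.rowLen 0)).filter fun j => μ.colLen j = c).card := by
    intro c
    have := congrArg (Multiset.count c) h.lengths
    rw [Multiset.count_map, Multiset.count_map] at this
    simp only [eq_comm (a := c)] at this
    exact this
  ext i
  simp only [colSet, Finset.mem_filter, Finset.mem_range, ← card]
  constructor
  · intro hi
    refine ⟨h.lt i hi, Finset.card_lt_card ?_⟩
    rw [Finset.ssubset_iff_of_subset]
    · exact ⟨i, by simp [hi], by simp⟩
    · intro j hj
      simp only [Finset.mem_filter, Finset.mem_range] at hj ⊢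
      obtain ⟨k, rfl⟩ := Nat.exists_eq_add_of_le hj.1.le
      exact ⟨down k j hj.2 hi, hj.2⟩
  · rintro ⟨_, hlt⟩
    by_contra hi
    refine absurd hlt (not_lt.2 (Finset.card_le_card ?_))
    intro j hj
    simp only [Finset.mem_filter, Finset.mem_range] at hj ⊢
    refine ⟨?_, hj.2⟩
    by_contra hle
    obtain ⟨k, rfl⟩ := Nat.exists_eq_add_of_le (not_lt.1 hle)
    exact hi (down k i hj.2.symm hj.1)

/-! ### Enhanced nilpotent orbits -/

/-- The coordinates on `ℂ^n × End(ℂ^n)`. -/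
inductive PairCoord (n : ℕ) : Type
  | v (a : Fin n)
  | x (a b : Fin n)

/-- The vector `v` of a point `(v, x)` of `ℂ^n × End(ℂ^n)`. -/
def vecOf {n : ℕ} (p : PairCoord n → ℂ) : Fin n → ℂ := fun a => p (.v a)

/-- The endomorphism `x` of a point `(v, x)` of `ℂ^n × End(ℂ^n)`. -/
def endOf {n : ℕ} (p : PairCoord n → ℂ) : Matrix (Fin n) (Fin n) ℂ :=
  Matrix.of fun a b => p (.x a b)

/-- The orbit `𝒪_{μ;ν}` in the enhanced nilpotent cone of `V = ℂ^n`: the pairs `(v, x)` for which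
`V` has a basis indexed by the boxes of `(μ; ν)` such that `x` sends each box to the box on its left
(or to `0` if there is none) and `v` is the sum of the boxes immediately left of the wall. Row `i`
of the diagram consists, from left to right, of the boxes `(i, 0), …, (i, μ_i + ν_i - 1)`, with the
wall after the first `μ_i` boxes. -/
def orbit (μ ν : YoungDiagram) (n : ℕ) : Set (PairCoord n → ℂ) :=
  {p | ∃ b : Module.Basis (sumDiagram μ ν).cells ℂ (Fin n → ℂ),
    (∀ c c' : (sumDiagram μ ν).cells, c.1.1 = c'.1.1 → c.1.2 = c'.1.2 + 1 →
      (endOf p).mulVec (b c) = b c') ∧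
    (∀ c : (sumDiagram μ ν).cells, c.1.2 = 0 → (endOf p).mulVec (b c) = 0) ∧
    vecOf p = ∑ c : (sumDiagram μ ν).cells with c.1.2 + 1 = μ.rowLen c.1.1, b c}

/-! ### Enhanced quiver varieties -/

/-- `dim U_i = r_0 + ⋯ + r_{i-1}`. -/
def dimU (r : ℕ → ℕ) (i : ℕ) : ℕ := ∑ j ∈ Finset.range i, r j

/-- The coordinates on `∏_{i ≤ t} U_i × ∏_{i < t} (Hom(U_i, U_{i+1}) × Hom(U_{i+1}, U_i))`,
where `U_i = ℂ^(d i)`. -/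
inductive QuiverCoord (d : ℕ → ℕ) (t : ℕ) : Type
  | u (i : ℕ) (hi : i ≤ t) (a : Fin (d i))
  | A (i : ℕ) (hi : i < t) (a : Fin (d (i + 1))) (b : Fin (d i))
  | B (i : ℕ) (hi : i < t) (a : Fin (d i)) (b : Fin (d (i + 1)))

section

variable {d : ℕ → ℕ} {t : ℕ}

/-- The vector `u_i ∈ U_i`. -/
def uOf (p : QuiverCoord d t → ℂ) (i : ℕ) (hi : i ≤ t) : Fin (d i) → ℂ := fun a => p (.u i hi a)

/-- The linear map `A_i : U_i → U_{i+1}`. -/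
def AOf (p : QuiverCoord d t → ℂ) (i : ℕ) (hi : i < t) :
    Matrix (Fin (d (i + 1))) (Fin (d i)) ℂ := Matrix.of fun a b => p (.A i hi a b)

/-- The linear map `B_i : U_{i+1} → U_i`. -/
def BOf (p : QuiverCoord d t → ℂ) (i : ℕ) (hi : i < t) :
    Matrix (Fin (d i)) (Fin (d (i + 1))) ℂ := Matrix.of fun a b => p (.B i hi a b)

end

/-- The enhanced quiver variety `Λ_{(r_0, …, r_{t-1}), I}`. -/
def quiverVariety (r : ℕ → ℕ) (t : ℕ) (I : Finset ℕ) : Set (QuiverCoord (dimU r) t → ℂ) :=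
  {p | (∀ (i : ℕ) (hi : i + 1 < t),
      BOf p (i + 1) hi * AOf p (i + 1) hi = AOf p i (by omega) * BOf p i (by omega)) ∧
    (∀ (i : ℕ) (hi : i < t), i ∈ I → (BOf p i hi).mulVec (uOf p (i + 1) hi) = uOf p i hi.le) ∧
    (∀ (i : ℕ) (hi : i < t), i ∉ I → (AOf p i hi).mulVec (uOf p i hi.le) = uOf p (i + 1) hi)}

/-- The enhanced quiver variety `Λ_{μ;ν} = Λ_{(r_i), I}` of the bipartition `(μ; ν)`. -/
def enhancedQuiverVariety (μ ν : YoungDiagram) :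
    Set (QuiverCoord (dimU (colSeq μ ν)) (numCols μ ν) → ℂ) :=
  quiverVariety (colSeq μ ν) (numCols μ ν) (colSet μ ν)

end EnhancedNilpotent

end

/-!
Write `t` for the number of columns of `λ = μ + ν` and `Λ` for the quiver variety. The proof realises
the closure of the orbit as a quotient of `Λ` in the invariant-theoretic sense, by means of the map
`π : (u_i, A_i, B_i) ↦ (u_t, A_{t-1} B_{t-1})`, and uses that a subring of a normal domain `S` that
contains all elements of `S` that are fractions of its own elements is normal
(`isIntegrallyClosed_of_injective`).

* `Λ` is irreducible (`isDomain_quiverVariety`). With suitable positive weights of the coordinates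
  it is a cone, so its coordinate ring embeds into the local ring at the vertex, which is a domain
  if `Λ` is normal.
* A regular function on `Λ` that is killed by `𝔤𝔩(U_i)` for all `i < t` is a polynomial in the entries
  of `u_t` and `A_{t-1} B_{t-1}` (`mem_range_of_invariant`). One eliminates `U_0`, `U_1`, … in turn:
  the maps that start or end in `U_i` are matrices `A` with columns, and `B` with rows, indexed
  by `U_i`, and the first fundamental theorem (`mem_adjoin_of_invariant`) leaves the entries of `AB`,
  which the equations of `Λ` express through the coordinates of higher level. The first fundamental
  theorem and the lifting of invariants through the quotient map `ℂ[A, B, y] → S` both follow from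
  positivity of the Fischer inner product `∑ α! conj(F_α) G_α`, for which multiplication by a
  variable is adjoint to the partial derivative. No complete reducibility is needed.
  A fraction of two functions in the image of `π^*` that is regular on `Λ` is killed by
  the `𝔤𝔩(U_i)`, hence lies in the image (`exists_proj_eq_of_mul_eq`).
* The kernel of `π^*` is the ideal of the orbit (`mem_vanishingIdeal_orbit_iff`). The standard point
  of `Λ`, whose spaces `U_i` have bases of boxes and whose maps move boxes, is mapped into the orbit,
  so `π(Λ)` contains the orbit. Conversely, the points of `Λ` with injective `A_i` and
  surjective `B_i` are dense by irreducibility. Up to `∏ GL(U_i)` their maps `A_i`, `B_i` are the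
  standard ones (`exists_quiver_conj`); then the equations confine `u_t` to the boxes
  left of the wall between `μ` and `ν` (`uOf_support`), and all such vectors that do not vanish at
  the boxes at the wall give points of the orbit (`exists_commute_mulVec`).
-/

noncomputable section

namespace EnhancedNilpotent

open MvPolynomial

/-! ### The Fischer inner product -/

section Fischer

variable {σ : Type*}

/-- The factorial `α! = ∏ α_v!` of an exponent vector. -/
def expFactorial (α : σ →₀ ℕ) : ℕ := α.prod fun _ k => k.factorial

theorem expFactorial_pos (α : σ →₀ ℕ) : 0 < expFactorial α :=
  Finset.prod_pos fun _ _ => Nat.factorial_pos _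

theorem expFactorial_add_single (α : σ →₀ ℕ) (v : σ) :
    expFactorial (α + Finsupp.single v 1) = (α v + 1) * expFactorial α := by
  classical
  have key : ∀ β : σ →₀ ℕ, expFactorial β = (β v).factorial * (β.erase v).prod fun _ k =>
      k.factorial := fun β =>
    (Finsupp.mul_prod_erase' β v (fun _ k => k.factorial) fun _ => Nat.factorial_zero).symm
  have he : (α + Finsupp.single v 1).erase v = α.erase v := by
    ext w
    by_cases h : w = v
    · simp [h]
    · simp [Finsupp.erase_ne h]
  rw [key, key α, he, Finsupp.add_apply, Finsupp.single_eq_same, Nat.factorial_succ, mul_assoc]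

/-- The Fischer inner product `⟨F, G⟩ = ∑ α! conj(F_α) G_α` on a polynomial ring over `ℂ`. It is
positive definite, and multiplication by a variable is adjoint to the partial derivative. -/
def fischer (F G : MvPolynomial σ ℂ) : ℂ :=
  ∑ α ∈ F.support, (expFactorial α : ℂ) * (starRingEnd ℂ (coeff α F) * coeff α G)

theorem fischer_eq_sum {F : MvPolynomial σ ℂ} {s : Finset (σ →₀ ℕ)} (h : F.support ⊆ s)
    (G : MvPolynomial σ ℂ) :
    fischer F G = ∑ α ∈ s, (expFactorial α : ℂ) * (starRingEnd ℂ (coeff α F) * coeff α G) :=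
  Finset.sum_subset h fun α _ hα => by rw [notMem_support_iff.1 hα]; simp

theorem fischer_conj_symm (F G : MvPolynomial σ ℂ) :
    starRingEnd ℂ (fischer G F) = fischer F G := by
  classical
  rw [fischer_eq_sum (F := G) (Finset.subset_union_right (s₁ := F.support)),
    fischer_eq_sum (F := F) (Finset.subset_union_left (s₂ := G.support)), map_sum]
  refine Finset.sum_congr rfl fun α _ => ?_
  simp only [map_mul, Complex.conj_conj, map_natCast]
  ring

theorem fischer_add_left (F G H : MvPolynomial σ ℂ) :
    fischer (F + G) H = fischer F H + fischer G H := by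
  classical
  rw [fischer_eq_sum (F := F) (Finset.subset_union_left (s₂ := G.support)),
    fischer_eq_sum (F := G) (Finset.subset_union_right (s₁ := F.support)),
    fischer_eq_sum support_add,
    ← Finset.sum_add_distrib]
  refine Finset.sum_congr rfl fun α _ => ?_
  rw [coeff_add, map_add]
  ring

theorem fischer_smul_left (F G : MvPolynomial σ ℂ) (c : ℂ) :
    fischer (c • F) G = starRingEnd ℂ c * fischer F G := by
  rw [fischer_eq_sum support_smul, fischer, Finset.mul_sum]
  refine Finset.sum_congr rfl fun α _ => ?_
  rw [coeff_smul, smul_eq_mul, map_mul]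
  ring

theorem fischer_self (F : MvPolynomial σ ℂ) :
    fischer F F = ((∑ α ∈ F.support, expFactorial α * Complex.normSq (coeff α F) : ℝ) : ℂ) := by
  rw [fischer, Complex.ofReal_sum]
  refine Finset.sum_congr rfl fun α _ => ?_
  rw [mul_comm (starRingEnd ℂ _), Complex.mul_conj]
  push_cast
  rfl

theorem fischer_self_re_nonneg (F : MvPolynomial σ ℂ) : 0 ≤ (fischer F F).re := by
  rw [fischer_self, Complex.ofReal_re]
  exact Finset.sum_nonneg fun α _ => mul_nonneg (Nat.cast_nonneg _) (Complex.normSq_nonneg _)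

theorem eq_zero_of_fischer_self_re {F : MvPolynomial σ ℂ} (h : (fischer F F).re = 0) : F = 0 := by
  rw [fischer_self, Complex.ofReal_re, Finset.sum_eq_zero_iff_of_nonneg fun α _ =>
    mul_nonneg (Nat.cast_nonneg _) (Complex.normSq_nonneg _)] at h
  ext α
  by_contra hα
  have := h α (mem_support_iff.2 hα)
  rw [mul_eq_zero, Nat.cast_eq_zero, Complex.normSq_eq_zero] at this
  exact this.elim (expFactorial_pos α).ne' hα

/-- The Fischer inner product as an inner product space structure. -/
abbrev fischerCore : InnerProductSpace.Core ℂ (MvPolynomial σ ℂ) where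
  inner := fischer
  conj_inner_symm F G := fischer_conj_symm F G
  re_inner_nonneg F := fischer_self_re_nonneg F
  add_left := fischer_add_left
  smul_left := fischer_smul_left
  definite F h := eq_zero_of_fischer_self_re (by
    change fischer F F = 0 at h
    rw [h, Complex.zero_re])

theorem exists_fischer_orthogonal (M : Submodule ℂ (MvPolynomial σ ℂ)) [FiniteDimensional ℂ M]
    (F : MvPolynomial σ ℂ) : ∃ m ∈ M, ∀ g ∈ M, fischer g (F - m) = 0 := by
  let : NormedAddCommGroup (MvPolynomial σ ℂ) :=
    @InnerProductSpace.Core.toNormedAddCommGroup ℂ _ _ _ _ fischerCore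
  let : InnerProductSpace ℂ (MvPolynomial σ ℂ) :=
    InnerProductSpace.ofCore (fischerCore (σ := σ)).toCore
  obtain ⟨m, hm, z, hz, hF⟩ := M.exists_add_mem_mem_orthogonal F
  refine ⟨m, hm, fun g hg => ?_⟩
  rw [hF, add_sub_cancel_left]
  exact (Submodule.mem_orthogonal M z).1 hz g hg

theorem fischer_add_right (F G H : MvPolynomial σ ℂ) :
    fischer F (G + H) = fischer F G + fischer F H := by
  rw [← fischer_conj_symm, fischer_add_left, map_add, fischer_conj_symm, fischer_conj_symm]

@[simp]
theorem fischer_zero_right (F : MvPolynomial σ ℂ) : fischer F 0 = 0 := by simp [fischer]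

theorem fischer_sum_left {ι : Type*} (s : Finset ι) (F : ι → MvPolynomial σ ℂ)
    (G : MvPolynomial σ ℂ) : fischer (∑ i ∈ s, F i) G = ∑ i ∈ s, fischer (F i) G :=
  map_sum (AddMonoidHom.mk' (fun F => fischer F G) fun F H => fischer_add_left F H G) F s

theorem fischer_sum_right {ι : Type*} (s : Finset ι) (F : MvPolynomial σ ℂ)
    (G : ι → MvPolynomial σ ℂ) : fischer F (∑ i ∈ s, G i) = ∑ i ∈ s, fischer F (G i) :=
  map_sum (AddMonoidHom.mk' (fischer F) (fischer_add_right F)) G s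

theorem fischer_sub_left (F G H : MvPolynomial σ ℂ) :
    fischer (F - G) H = fischer F H - fischer G H :=
  map_sub (AddMonoidHom.mk' (fun F => fischer F H) fun F G => fischer_add_left F G H) F G

theorem fischer_sub_right (F G H : MvPolynomial σ ℂ) :
    fischer F (G - H) = fischer F G - fischer F H :=
  map_sub (AddMonoidHom.mk' (fischer F) (fischer_add_right F)) G H

theorem fischer_X_mul_left (v : σ) (F G : MvPolynomial σ ℂ) :
    fischer (X v * F) G = fischer F (pderiv v G) := by
  rw [fischer, support_X_mul, Finset.sum_map, fischer]
  refine Finset.sum_congr rfl fun α _ => ?_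
  rw [addLeftEmbedding_apply, coeff_X_mul, coeff_pderiv, add_comm, expFactorial_add_single]
  push_cast
  ring

theorem fischer_X_mul_right (v : σ) (F G : MvPolynomial σ ℂ) :
    fischer F (X v * G) = fischer (pderiv v F) G := by
  rw [← fischer_conj_symm, fischer_X_mul_left, fischer_conj_symm]

theorem coeff_X_mul_pderiv (v : σ) (F : MvPolynomial σ ℂ) (α : σ →₀ ℕ) :
    coeff α (X v * pderiv v F) = α v * coeff α F := by
  classical
  rw [coeff_X_mul']
  split_ifs with h
  · have h1 : α - Finsupp.single v 1 + Finsupp.single v 1 = α := by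
      refine tsub_add_cancel_of_le (Finsupp.single_le_iff.2 ?_)
      have := Finsupp.mem_support_iff.1 h
      omega
    have h2 : ((α - Finsupp.single v 1 : σ →₀ ℕ) v : ℂ) + 1 = α v := by
      conv_rhs => rw [← h1]
      simp
    rw [coeff_pderiv, h1, h2, mul_comm]
  · rw [Finsupp.notMem_support_iff.1 h]
    simp

/-- The polynomials of total degree less than `d`. Unlike the bound `≤ d - 1` this makes sense, and
leaves only `0`, at `d = 0`. -/
def degreeLT (σ : Type*) (d : ℕ) : Submodule ℂ (MvPolynomial σ ℂ) :=
  restrictSupport ℂ {α | α.degree < d}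

theorem mem_degreeLT {d : ℕ} {F : MvPolynomial σ ℂ} :
    F ∈ degreeLT σ d ↔ ∀ α, coeff α F ≠ 0 → α.degree < d := by
  rw [degreeLT, mem_restrictSupport_iff]
  exact ⟨fun h α hα => h (mem_support_iff.2 hα), fun h α hα => h α (mem_support_iff.1 hα)⟩

theorem exists_mem_degreeLT (F : MvPolynomial σ ℂ) : ∃ d, F ∈ degreeLT σ d := by
  refine ⟨F.support.sup Finsupp.degree + 1, mem_degreeLT.2 fun α hα => ?_⟩
  exact Nat.lt_succ_of_le (Finset.le_sup (f := Finsupp.degree) (mem_support_iff.2 hα))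

theorem eq_zero_of_mem_degreeLT_zero {F : MvPolynomial σ ℂ} (h : F ∈ degreeLT σ 0) : F = 0 := by
  ext α
  by_contra hα
  exact absurd (mem_degreeLT.1 h α hα) (Nat.not_lt_zero _)

theorem pderiv_mem_degreeLT {d : ℕ} {F : MvPolynomial σ ℂ} (v : σ) (h : F ∈ degreeLT σ (d + 1)) :
    pderiv v F ∈ degreeLT σ d := by
  refine mem_degreeLT.2 fun α hα => ?_
  rw [coeff_pderiv] at hα
  have := mem_degreeLT.1 h _ (left_ne_zero_of_mul hα)
  rw [map_add, Finsupp.degree_single] at this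
  omega

theorem X_mul_mem_degreeLT {d : ℕ} {F : MvPolynomial σ ℂ} (v : σ) (h : F ∈ degreeLT σ d) :
    X v * F ∈ degreeLT σ (d + 1) := by
  classical
  refine mem_degreeLT.2 fun α hα => ?_
  rw [coeff_X_mul'] at hα
  split_ifs at hα with hv
  · have h1 : α - Finsupp.single v 1 + Finsupp.single v 1 = α := by
      refine tsub_add_cancel_of_le (Finsupp.single_le_iff.2 ?_)
      have := Finsupp.mem_support_iff.1 hv
      omega
    have := mem_degreeLT.1 h _ hα
    rw [← h1, map_add, Finsupp.degree_single]
    omega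
  · exact absurd rfl hα

theorem X_mul_pderiv_mem_degreeLT {d : ℕ} {F : MvPolynomial σ ℂ} (v w : σ)
    (h : F ∈ degreeLT σ d) : X v * pderiv w F ∈ degreeLT σ d := by
  cases d with
  | zero => rw [eq_zero_of_mem_degreeLT_zero h, map_zero, mul_zero]; exact zero_mem _
  | succ d => exact X_mul_mem_degreeLT v (pderiv_mem_degreeLT w h)

instance [Finite σ] (d : ℕ) : FiniteDimensional ℂ (degreeLT σ d) := by
  refine Submodule.finiteDimensional_of_le (S₂ := restrictTotalDegree σ ℂ d) fun F hF => ?_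
  rw [mem_restrictTotalDegree, totalDegree, Finset.sup_le_iff]
  exact fun α hα => (mem_degreeLT.1 hF α (mem_support_iff.1 hα)).le

end Fischer

theorem pderiv_pderiv_comm {σ : Type*} (v w : σ) (F : MvPolynomial σ ℂ) :
    pderiv v (pderiv w F) = pderiv w (pderiv v F) := by
  classical
  rcases eq_or_ne v w with rfl | h
  · rfl
  ext α
  simp only [coeff_pderiv, Finsupp.add_apply, Finsupp.single_apply, h, h.symm, if_false, add_zero]
  rw [add_right_comm]
  ring

/-! ### Invariants of vectors and covectors -/

section Invariants

variable {q m r τ : Type*}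

/-- The polynomial ring `ℂ[A, B, y]` in the entries `A_{ij} = X (inl (i, j))` of a `q × m` matrix,
the entries `B_{ij} = X (inr (inl (i, j)))` of an `m × r` matrix, and further variables
`y_c = X (inr (inr c))`. -/
abbrev MatPoly (q m r τ : Type*) := MvPolynomial (q × m ⊕ m × r ⊕ τ) ℂ

section Operators

/-- The operator `∑_k A_{ki} ∂/∂A_{kj}`. -/
def polA (r τ : Type*) {q m : Type*} [Fintype q] (i j : m) :
    Derivation ℂ (MatPoly q m r τ) (MatPoly q m r τ) :=
  ∑ k : q, (X (.inl (k, i)) : MatPoly q m r τ) • pderiv (.inl (k, j))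

/-- The operator `∑_k B_{jk} ∂/∂B_{ik}`. -/
def polB (q τ : Type*) {m r : Type*} [Fintype r] (i j : m) :
    Derivation ℂ (MatPoly q m r τ) (MatPoly q m r τ) :=
  ∑ k : r, (X (.inr (.inl (j, k))) : MatPoly q m r τ) • pderiv (.inr (.inl (i, k)))

/-- The action of the matrix unit `E_{ij}` of `𝔤𝔩_m` on `ℂ[A, B, y]`: it is the derivation with
`B ↦ E_{ij} B`, `A ↦ -A E_{ij}`, `y ↦ 0`. -/
def glAct (q r τ : Type*) {m : Type*} [Fintype q] [Fintype r] (i j : m) :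
    Derivation ℂ (MatPoly q m r τ) (MatPoly q m r τ) :=
  polB q τ i j - polA r τ i j

theorem polA_apply [Fintype q] (i j : m) (F : MatPoly q m r τ) :
    polA r τ i j F = ∑ k : q, X (.inl (k, i)) * pderiv (.inl (k, j)) F := by
  rw [polA, ← Derivation.coeFnAddMonoidHom_apply, map_sum, Finset.sum_apply]
  rfl

theorem polB_apply [Fintype r] (i j : m) (F : MatPoly q m r τ) :
    polB q τ i j F = ∑ k : r, X (.inr (.inl (j, k))) * pderiv (.inr (.inl (i, k))) F := by
  rw [polB, ← Derivation.coeFnAddMonoidHom_apply, map_sum, Finset.sum_apply]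
  rfl

variable [Fintype q] [Fintype r]

theorem glAct_apply (i j : m) (F : MatPoly q m r τ) :
    glAct q r τ i j F = polB q τ i j F - polA r τ i j F := rfl

theorem glAct_mem_degreeLT {d : ℕ} (i j : m) {F : MatPoly q m r τ} (hF : F ∈ degreeLT _ d) :
    glAct q r τ i j F ∈ degreeLT _ d := by
  rw [glAct_apply, polA_apply, polB_apply]
  exact sub_mem (sum_mem fun k _ => X_mul_pderiv_mem_degreeLT _ _ hF)
    (sum_mem fun k _ => X_mul_pderiv_mem_degreeLT _ _ hF)

/-- The adjoint of `E_{ij}` for the Fischer inner product is `E_{ji}`. -/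
theorem fischer_glAct_left (i j : m) (F G : MatPoly q m r τ) :
    fischer (glAct q r τ i j F) G = fischer F (glAct q r τ j i G) := by
  simp only [glAct_apply, polA_apply, polB_apply, fischer_sub_left, fischer_sub_right,
    fischer_sum_left, fischer_sum_right, fischer_X_mul_left, fischer_X_mul_right]

theorem glAct_varA [DecidableEq m] (i j : m) (k : q) (l : m) :
    glAct q r τ i j (X (.inl (k, l))) = if l = j then -X (.inl (k, i)) else 0 := by
  classical
  simp only [glAct_apply, polA_apply, polB_apply, pderiv_X, Pi.single_apply]
  by_cases h : l = j <;> simp [h]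

theorem glAct_varB [DecidableEq m] (i j : m) (k : r) (l : m) :
    glAct q r τ i j (X (.inr (.inl (l, k)))) = if l = i then X (.inr (.inl (j, k))) else 0 := by
  classical
  simp only [glAct_apply, polA_apply, polB_apply, pderiv_X, Pi.single_apply]
  by_cases h : l = i <;> simp [h]

theorem glAct_varY (i j : m) (c : τ) : glAct q r τ i j (X (.inr (.inr c))) = 0 := by
  classical
  simp [glAct_apply, polA_apply, polB_apply, pderiv_X]

end Operators

section Products

variable [Fintype m]

/-- The entry `(AB)_{kl}`. -/
def prodEntry (τ : Type*) {q m r : Type*} [Fintype m] (k : q) (l : r) : MatPoly q m r τ :=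
  ∑ i, X (.inl (k, i)) * X (.inr (.inl (i, l)))

/-- The operator `∑_i ∂²/∂A_{ki}∂B_{il}`, which is adjoint to multiplication by `(AB)_{kl}`. -/
def laplace (k : q) (l : r) (F : MatPoly q m r τ) : MatPoly q m r τ :=
  ∑ i, pderiv (.inl (k, i)) (pderiv (.inr (.inl (i, l))) F)

theorem fischer_prodEntry_mul (k : q) (l : r) (F G : MatPoly q m r τ) :
    fischer (prodEntry τ k l * F) G = fischer F (laplace k l G) := by
  simp only [prodEntry, laplace, Finset.sum_mul, fischer_sum_left, fischer_sum_right, mul_assoc,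
    fischer_X_mul_left]
  refine Finset.sum_congr rfl fun i _ => ?_
  rw [pderiv_pderiv_comm]

theorem prodEntry_mul_mem_degreeLT {d : ℕ} (k : q) (l : r) {F : MatPoly q m r τ}
    (hF : F ∈ degreeLT _ d) : prodEntry τ k l * F ∈ degreeLT _ (d + 2) := by
  rw [prodEntry, Finset.sum_mul]
  refine sum_mem fun i _ => ?_
  rw [mul_assoc]
  exact X_mul_mem_degreeLT _ (X_mul_mem_degreeLT _ hF)

theorem laplace_mem_degreeLT {d : ℕ} (k : q) (l : r) {F : MatPoly q m r τ}
    (hF : F ∈ degreeLT _ (d + 2)) : laplace k l F ∈ degreeLT _ d :=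
  sum_mem fun _ _ => pderiv_mem_degreeLT _ (pderiv_mem_degreeLT _ hF)

/-- The subalgebra `ℂ[AB, y]` of `ℂ[A, B, y]`. -/
def prodSubalgebra (q m r τ : Type*) [Fintype m] : Subalgebra ℂ (MatPoly q m r τ) :=
  Algebra.adjoin ℂ (Set.range (fun kl : q × r => prodEntry τ kl.1 kl.2) ∪
    Set.range fun c : τ => X (.inr (.inr c)))

theorem prodEntry_mem (k : q) (l : r) : prodEntry τ k l ∈ prodSubalgebra q m r τ :=
  Algebra.subset_adjoin (.inl ⟨(k, l), rfl⟩)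

theorem varY_mem (c : τ) : X (.inr (.inr c)) ∈ prodSubalgebra q m r τ :=
  Algebra.subset_adjoin (.inr ⟨c, rfl⟩)

theorem monomial_mem_prodSubalgebra {α : (q × m ⊕ m × r ⊕ τ) →₀ ℕ}
    (hα : (∀ ki, α (.inl ki) = 0) ∧ ∀ il, α (.inr (.inl il)) = 0) (c : ℂ) :
    monomial α c ∈ prodSubalgebra q m r τ := by
  rw [monomial_eq]
  refine mul_mem (Subalgebra.algebraMap_mem _ c) (Subalgebra.prod_mem _ fun v hv => ?_)
  rcases v with ki | il | y
  · exact absurd (hα.1 ki) (Finsupp.mem_support_iff.1 hv)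
  · exact absurd (hα.2 il) (Finsupp.mem_support_iff.1 hv)
  · exact pow_mem (varY_mem y) _

variable [Fintype q] [Fintype r]

theorem glAct_prodEntry (i j : m) (k : q) (l : r) : glAct q r τ i j (prodEntry τ k l) = 0 := by
  classical
  simp [prodEntry, glAct_varA, glAct_varB, Finset.sum_add_distrib, mul_comm]

theorem glAct_eq_zero_of_mem (i j : m) {g : MatPoly q m r τ} (hg : g ∈ prodSubalgebra q m r τ) :
    glAct q r τ i j g = 0 := by
  induction hg using Algebra.adjoin_induction with
  | mem x hx =>
    obtain ⟨kl, rfl⟩ | ⟨c, rfl⟩ := hx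
    · exact glAct_prodEntry i j _ _
    · exact glAct_varY i j c
  | algebraMap c => exact Derivation.map_algebraMap _ c
  | add x y _ _ hx hy => rw [map_add, hx, hy, add_zero]
  | mul x y _ _ hx hy => rw [Derivation.leibniz, hx, hy, smul_zero, smul_zero, add_zero]

theorem glAct_laplace (k : q) (l : r) {F : MatPoly q m r τ} (hF : ∀ i j, glAct q r τ i j F = 0)
    (i j : m) : glAct q r τ i j (laplace k l F) = 0 := by
  refine eq_zero_of_fischer_self_re ?_
  rw [← fischer_glAct_left, ← fischer_prodEntry_mul]
  have h : ∀ G, prodEntry τ k l * glAct q r τ j i G = glAct q r τ j i (prodEntry τ k l * G) :=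
    fun G => by rw [Derivation.leibniz, glAct_prodEntry, smul_zero, add_zero, smul_eq_mul]
  rw [h, fischer_glAct_left, hF, fischer_zero_right, Complex.zero_re]

/-- An invariant that is killed by all the operators `∑_i ∂²/∂A_{ki}∂B_{il}` is killed by `𝔤𝔩_m`
acting on the matrix `A` alone: the sum of the squared norms of `D_{ij} F`, where
`D_{ij} = ∑_k A_{ki} ∂/∂A_{kj}`, collapses once one of the two factors is rewritten in terms of
`B`. -/
theorem polA_eq_zero {F : MatPoly q m r τ} (hF : ∀ i j, glAct q r τ i j F = 0)
    (hL : ∀ k l, laplace k l F = 0) (i j : m) : polA r τ i j F = 0 := by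
  have hAB : ∀ i j, polB q τ i j F = polA r τ i j F := fun i j => sub_eq_zero.1 (hF i j)
  have key : ∑ i, fischer (polA r τ i j F) (polA r τ i j F) = 0 := by
    have hne : ∀ (k : q) (l : r) (i : m) (H : MatPoly q m r τ),
        pderiv (.inl (k, i)) (X (.inr (.inl (j, l))) * H) =
          X (.inr (.inl (j, l))) * pderiv (.inl (k, i)) H := by
      intro k l i H
      rw [pderiv_mul, pderiv_X_of_ne (by simp), zero_mul, zero_add]
    have h1 : ∀ i, fischer (polA r τ i j F) (polA r τ i j F) =
        ∑ k, ∑ l, fischer (pderiv (.inl (k, j)) F)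
          (X (.inr (.inl (j, l))) * pderiv (.inl (k, i)) (pderiv (.inr (.inl (i, l))) F)) := by
      intro i
      nth_rw 2 [← hAB]
      rw [polB_apply, polA_apply, fischer_sum_left]
      simp only [fischer_X_mul_left, fischer_sum_right, hne]
    simp only [h1]
    rw [Finset.sum_comm]
    refine Finset.sum_eq_zero fun k _ => ?_
    rw [Finset.sum_comm]
    refine Finset.sum_eq_zero fun l _ => ?_
    rw [← fischer_sum_right, ← Finset.mul_sum]
    change fischer _ (_ * laplace k l F) = 0
    rw [hL, mul_zero, fischer_zero_right]
  have h2 := congrArg Complex.re key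
  rw [Complex.re_sum, Complex.zero_re,
    Finset.sum_eq_zero_iff_of_nonneg fun i _ => fischer_self_re_nonneg _] at h2
  exact eq_zero_of_fischer_self_re (h2 i (Finset.mem_univ i))

/-- An invariant that is killed by all the operators `∑_i ∂²/∂A_{ki}∂B_{il}` does not involve the
entries of `A` and `B`. -/
theorem exponents_eq_zero {F : MatPoly q m r τ} (hF : ∀ i j, glAct q r τ i j F = 0)
    (hL : ∀ k l, laplace k l F = 0) {α : (q × m ⊕ m × r ⊕ τ) →₀ ℕ} (hα : coeff α F ≠ 0) :
    (∀ ki, α (.inl ki) = 0) ∧ ∀ il, α (.inr (.inl il)) = 0 := by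
  have hA := fun i => polA_eq_zero hF hL i i
  have hB : ∀ i, polB q τ i i F = 0 := fun i => (sub_eq_zero.1 (hF i i)).trans (hA i)
  constructor
  · rintro ⟨k, i⟩
    have h := congrArg (coeff α) (hA i)
    simp only [polA_apply, coeff_sum, coeff_X_mul_pderiv, coeff_zero, ← Finset.sum_mul] at h
    have h := (mul_eq_zero.1 h).resolve_right hα
    rw [← Nat.cast_sum, Nat.cast_eq_zero, Finset.sum_eq_zero_iff] at h
    exact h k (Finset.mem_univ k)
  · rintro ⟨i, l⟩
    have h := congrArg (coeff α) (hB i)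
    simp only [polB_apply, coeff_sum, coeff_X_mul_pderiv, coeff_zero, ← Finset.sum_mul] at h
    have h := (mul_eq_zero.1 h).resolve_right hα
    rw [← Nat.cast_sum, Nat.cast_eq_zero, Finset.sum_eq_zero_iff] at h
    exact h l (Finset.mem_univ l)

/-- The first fundamental theorem for `𝔤𝔩_m`: the only invariant orthogonal to `ℂ[AB, y]` is `0`.
The operators adjoint to multiplication by the entries of `AB` lower the degree and preserve the
hypotheses, so by induction they kill `F`, which is then a polynomial in `y`. -/
theorem eq_zero_of_orthogonal_prodSubalgebra (d : ℕ) (F : MatPoly q m r τ)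
    (hd : F ∈ degreeLT _ d) (hF : ∀ i j, glAct q r τ i j F = 0)
    (horth : ∀ g ∈ prodSubalgebra q m r τ, g ∈ degreeLT _ d → fischer g F = 0) : F = 0 := by
  induction d using Nat.strong_induction_on generalizing F with
  | _ d ih =>
    have hL : ∀ k l, laplace k l F = 0 := by
      intro k l
      match d, ih, hd, horth with
      | 0, _, hd, _ =>
        rw [eq_zero_of_mem_degreeLT_zero hd]
        simp [laplace]
      | 1, _, hd, _ =>
        refine Finset.sum_eq_zero fun i _ => ?_
        rw [eq_zero_of_mem_degreeLT_zero (pderiv_mem_degreeLT _ hd), map_zero]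
      | d + 2, ih, hd, horth =>
        refine ih d (by omega) _ (laplace_mem_degreeLT k l hd) (glAct_laplace k l hF) ?_
        intro g hg hgd
        rw [← fischer_prodEntry_mul]
        exact horth _ (mul_mem (prodEntry_mem k l) hg) (prodEntry_mul_mem_degreeLT k l hgd)
    refine eq_zero_of_fischer_self_re ?_
    rw [horth F ?_ hd, Complex.zero_re]
    rw [F.as_sum]
    exact sum_mem fun α hα =>
      monomial_mem_prodSubalgebra (exponents_eq_zero hF hL (mem_support_iff.1 hα)) _

/-- If `I` is a `𝔤𝔩_m`-stable subspace of `ℂ[A, B, y]` and `F` is invariant modulo `I`, then `F` is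
congruent modulo `I` to a polynomial in `y` and the entries of `AB`. The difference of `F` and its
Fischer projection to `I + ℂ[AB, y]` (in bounded degree) is invariant, since `𝔤𝔩_m` maps it into
`I`, to which it is orthogonal, and `𝔤𝔩_m` is closed under adjoints; so it is `0`. -/
theorem exists_mem_prodSubalgebra_sub_mem [Finite τ] (I : Submodule ℂ (MatPoly q m r τ))
    (hI : ∀ i j, ∀ F ∈ I, glAct q r τ i j F ∈ I) (F : MatPoly q m r τ)
    (hF : ∀ i j, glAct q r τ i j F ∈ I) : ∃ g ∈ prodSubalgebra q m r τ, F - g ∈ I := by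
  obtain ⟨d, hd⟩ := exists_mem_degreeLT F
  set N : Submodule ℂ (MatPoly q m r τ) := (prodSubalgebra q m r τ).toSubmodule
  obtain ⟨p, hp, horth⟩ := exists_fischer_orthogonal ((I ⊔ N) ⊓ degreeLT _ d) F
  obtain ⟨⟨a, ha, g, hg, rfl⟩, hpd⟩ := And.imp_left Submodule.mem_sup.1 (Submodule.mem_inf.1 hp)
  have hFd : F - (a + g) ∈ degreeLT _ d := sub_mem hd hpd
  have hmem : ∀ i j, glAct q r τ i j (F - (a + g)) ∈ I := fun i j => by
    rw [map_sub, map_add, glAct_eq_zero_of_mem i j hg, add_zero]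
    exact sub_mem (hF i j) (hI i j a ha)
  have hinv : ∀ i j, glAct q r τ i j (F - (a + g)) = 0 := fun i j => by
    refine eq_zero_of_fischer_self_re ?_
    rw [← fischer_glAct_left, horth, Complex.zero_re]
    exact Submodule.mem_inf.2 ⟨Submodule.mem_sup_left (hI _ _ _ (hmem i j)),
      glAct_mem_degreeLT _ _ (glAct_mem_degreeLT _ _ hFd)⟩
  have h0 := eq_zero_of_orthogonal_prodSubalgebra d _ hFd hinv fun g hg hgd =>
    horth g (Submodule.mem_inf.2 ⟨Submodule.mem_sup_right hg, hgd⟩)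
  refine ⟨g, hg, ?_⟩
  rw [sub_eq_zero.1 h0, add_sub_cancel_right]
  exact ha

/-- The first fundamental theorem for `𝔤𝔩_m` in an arbitrary commutative `ℂ`-algebra `S`: if `𝔤𝔩_m`
acts on `S` by derivations, multiplies the matrix `A` from the right and `B` from the left and kills
`T`, then all invariants in the subalgebra generated by `A`, `B`, `T` are polynomials in `AB`
and `T`. -/
theorem mem_adjoin_of_invariant {S : Type*} [CommRing S] [Algebra ℂ S] [DecidableEq m]
    (D : m → m → Derivation ℂ S S) (A : Matrix q m S) (B : Matrix m r S) {T : Set S}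
    (hT : T.Finite) (hA : ∀ i j k l, D i j (A k l) = if l = j then -A k i else 0)
    (hB : ∀ i j k l, D i j (B k l) = if k = i then B j l else 0)
    (hDT : ∀ i j, ∀ y ∈ T, D i j y = 0) {f : S}
    (hf : f ∈ Algebra.adjoin ℂ ((Set.range fun kl : q × m => A kl.1 kl.2) ∪
      (Set.range fun kl : m × r => B kl.1 kl.2) ∪ T)) (hDf : ∀ i j, D i j f = 0) :
    f ∈ Algebra.adjoin ℂ ((Set.range fun kl : q × r => (A * B) kl.1 kl.2) ∪ T) := by
  have : Finite T := hT
  let φ : MatPoly q m r T →ₐ[ℂ] S := aeval (Sum.elim (fun kl => A kl.1 kl.2)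
    (Sum.elim (fun kl => B kl.1 kl.2) (fun y => (y : S))))
  have hφ : ∀ i j F, φ (glAct q r T i j F) = D i j (φ F) := by
    intro i j F
    induction F using MvPolynomial.induction_on with
    | C a => rw [← algebraMap_eq, Derivation.map_algebraMap, AlgHom.commutes,
        Derivation.map_algebraMap, map_zero]
    | add F G hF hG => simp only [map_add, hF, hG]
    | mul_X F v hF =>
      simp only [Derivation.leibniz, map_add, map_mul, hF, smul_eq_mul]
      congr 2
      rcases v with kl | kl | y
      · rw [glAct_varA]
        split_ifs with h <;> simp [φ, hA, h]
      · rw [glAct_varB]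
        split_ifs with h <;> simp [φ, hB, h]
      · rw [glAct_varY]
        simp [φ, hDT i j y y.2]
  have hrange : f ∈ φ.range := by
    refine (Algebra.adjoin_le ?_ : _ ≤ φ.range) hf
    rintro _ ((⟨kl, rfl⟩ | ⟨kl, rfl⟩) | hy)
    · exact ⟨X (.inl kl), by simp [φ]⟩
    · exact ⟨X (.inr (.inl kl)), by simp [φ]⟩
    · exact ⟨X (.inr (.inr ⟨_, hy⟩)), by simp [φ]⟩
  obtain ⟨F, rfl⟩ := hrange
  obtain ⟨g, hg, hFg⟩ := exists_mem_prodSubalgebra_sub_mem (LinearMap.ker φ.toLinearMap)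
    (fun i j F hF => by
      have hF : φ F = 0 := hF
      change φ _ = 0
      rw [hφ, hF, map_zero]) F
    (fun i j => by
      change φ _ = 0
      rw [hφ]
      exact hDf i j)
  have hFg : φ (F - g) = 0 := hFg
  have heq : φ F = φ g := sub_eq_zero.1 ((map_sub φ F g).symm.trans hFg)
  change φ F ∈ _
  rw [heq]
  have hg' : φ g ∈ (prodSubalgebra q m r T).map φ := ⟨g, hg, rfl⟩
  rw [prodSubalgebra, AlgHom.map_adjoin] at hg'
  refine Algebra.adjoin_mono ?_ hg'
  rintro _ ⟨_, ⟨kl, rfl⟩ | ⟨y, rfl⟩, rfl⟩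
  · exact .inl ⟨kl, by simp [φ, prodEntry, Matrix.mul_apply]⟩
  · exact .inr (by simp [φ])

end Products

end Invariants

/-! ### Coordinate rings and derivations -/

section CoordinateRings

variable {σ : Type} {V : Set (σ → ℂ)}

/-- Evaluation of regular functions at a point of a closed set. -/
def evalPoint (p : V) : CoordinateRing V →ₐ[ℂ] ℂ :=
  Ideal.Quotient.liftₐ _ (aeval (p : σ → ℂ)) fun _ hf => hf p p.2

/-- The class of a polynomial in the coordinate ring. -/
abbrev toCoordinateRing (V : Set (σ → ℂ)) : MvPolynomial σ ℂ →ₐ[ℂ] CoordinateRing V :=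
  Ideal.Quotient.mkₐ ℂ (vanishingIdeal ℂ V)

/-- A coordinate function. -/
def coord (V : Set (σ → ℂ)) (c : σ) : CoordinateRing V := toCoordinateRing V (X c)

@[simp]
theorem evalPoint_toCoordinateRing (p : V) (F : MvPolynomial σ ℂ) :
    evalPoint p (toCoordinateRing V F) = aeval (p : σ → ℂ) F := rfl

@[simp]
theorem evalPoint_coord (p : V) (c : σ) : evalPoint p (coord V c) = (p : σ → ℂ) c := by
  rw [coord, evalPoint_toCoordinateRing, aeval_X]

theorem toCoordinateRing_surjective (V : Set (σ → ℂ)) :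
    Function.Surjective (toCoordinateRing V) := Ideal.Quotient.mkₐ_surjective ℂ _

theorem toCoordinateRing_eq_zero {F : MvPolynomial σ ℂ} :
    toCoordinateRing V F = 0 ↔ ∀ p ∈ V, aeval p F = 0 := Ideal.Quotient.eq_zero_iff_mem

theorem coordinateRing_ext {x y : CoordinateRing V} (h : ∀ p, evalPoint p x = evalPoint p y) :
    x = y := by
  obtain ⟨F, hF⟩ := toCoordinateRing_surjective V (x - y)
  rw [← sub_eq_zero, ← hF, toCoordinateRing_eq_zero]
  intro p hp
  rw [← evalPoint_toCoordinateRing ⟨p, hp⟩, hF, map_sub, h, sub_self]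

theorem adjoin_coord (V : Set (σ → ℂ)) : Algebra.adjoin ℂ (Set.range (coord V)) = ⊤ := by
  have h := congrArg (Subalgebra.map (toCoordinateRing V)) (adjoin_range_X (R := ℂ) (σ := σ))
  rw [AlgHom.map_adjoin, Algebra.map_top, ← Set.range_comp,
    (AlgHom.range_eq_top _).2 (toCoordinateRing_surjective V)] at h
  exact h

/-- The derivation induced on a quotient by an ideal that is stable under a derivation. -/
def quotientDerivation {P : Type*} [CommRing P] [Algebra ℂ P] (J : Ideal P) (D : Derivation ℂ P P)
    (h : ∀ F ∈ J, D F ∈ J) : Derivation ℂ (P ⧸ J) (P ⧸ J) :=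
  have key : ∀ F G : P, Ideal.Quotient.mk J F = Ideal.Quotient.mk J G →
      Ideal.Quotient.mk J (D F) = Ideal.Quotient.mk J (D G) := fun F G hFG => by
    rw [Ideal.Quotient.eq] at hFG ⊢
    rw [← map_sub]
    exact h _ hFG
  Derivation.mk'
    { toFun := fun x => Ideal.Quotient.mk J (D x.out)
      map_add' := fun x y => by
        rw [← map_add, ← map_add]
        exact key _ _ (by rw [map_add, Ideal.Quotient.mk_out, Ideal.Quotient.mk_out,
          Ideal.Quotient.mk_out])
      map_smul' := fun c x => by
        rw [RingHom.id_apply, ← Ideal.Quotient.mkₐ_eq_mk ℂ, ← map_smul, ← Derivation.map_smul]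
        refine key _ _ ?_
        rw [← Ideal.Quotient.mkₐ_eq_mk ℂ, map_smul, Ideal.Quotient.mkₐ_eq_mk,
          Ideal.Quotient.mk_out, Ideal.Quotient.mk_out] }
    fun x y => by
      change Ideal.Quotient.mk J (D (x * y).out) =
        x * Ideal.Quotient.mk J (D y.out) + y * Ideal.Quotient.mk J (D x.out)
      rw [key (x * y).out (x.out * y.out) (by rw [map_mul, Ideal.Quotient.mk_out,
        Ideal.Quotient.mk_out, Ideal.Quotient.mk_out]), Derivation.leibniz, smul_eq_mul,
        smul_eq_mul, map_add, map_mul, map_mul, Ideal.Quotient.mk_out, Ideal.Quotient.mk_out]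

theorem quotientDerivation_mk {P : Type*} [CommRing P] [Algebra ℂ P] (J : Ideal P)
    (D : Derivation ℂ P P) (h : ∀ F ∈ J, D F ∈ J) (F : P) :
    quotientDerivation J D h (Ideal.Quotient.mk J F) = Ideal.Quotient.mk J (D F) := by
  change Ideal.Quotient.mk J (D (Ideal.Quotient.mk J F).out) = _
  rw [Ideal.Quotient.eq, ← map_sub]
  refine h _ ?_
  rw [← Ideal.Quotient.eq, Ideal.Quotient.mk_out]

theorem hasDerivAt_aeval {γ : ℂ → σ → ℂ} {D : Derivation ℂ (MvPolynomial σ ℂ) (MvPolynomial σ ℂ)}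
    (hγ : ∀ c, HasDerivAt (fun z => γ z c) (aeval (γ 0) (D (X c))) 0) (F : MvPolynomial σ ℂ) :
    HasDerivAt (fun z => aeval (γ z) F) (aeval (γ 0) (D F)) 0 := by
  induction F using MvPolynomial.induction_on with
  | C a =>
    rw [← algebraMap_eq, Derivation.map_algebraMap, map_zero]
    simp only [AlgHom.commutes]
    exact hasDerivAt_const _ _
  | add F G hF hG =>
    simp only [map_add]
    exact hF.add hG
  | mul_X F c hF =>
    simp only [Derivation.leibniz, map_mul, map_add, smul_eq_mul, aeval_X]
    refine (hF.mul (hγ c)).congr_deriv ?_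
    ring

/-- A derivation of the polynomial ring preserves the ideal of `V` if through every point of `V`
there is a curve in `V` that has the velocity prescribed by the derivation. -/
theorem derivation_mem_vanishingIdeal
    {D : Derivation ℂ (MvPolynomial σ ℂ) (MvPolynomial σ ℂ)}
    (h : ∀ p ∈ V, ∃ γ : ℂ → σ → ℂ, γ 0 = p ∧ (∀ᶠ z in nhds 0, γ z ∈ V) ∧
      ∀ c, HasDerivAt (fun z => γ z c) (aeval p (D (X c))) 0)
    {F : MvPolynomial σ ℂ} (hF : F ∈ vanishingIdeal ℂ V) : D F ∈ vanishingIdeal ℂ V := by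
  intro p hp
  obtain ⟨γ, rfl, hV, hγ⟩ := h p hp
  refine (hasDerivAt_aeval hγ F).unique ?_
  refine (hasDerivAt_const (0 : ℂ) (0 : ℂ)).congr_of_eventuallyEq ?_
  filter_upwards [hV] with z hz using hF _ hz

end CoordinateRings

/-! ### Change of bases on the quiver variety -/

section Action

variable {d : ℕ → ℕ} {t : ℕ}

/-- The point `(g_i u_i, g_{i+1} A_i h_i, g_i B_i h_{i+1})`; with `h_i = g_i⁻¹` this is the action of
`∏ GL(U_i)`. -/
def actPoint (g h : ∀ i, Matrix (Fin (d i)) (Fin (d i)) ℂ) (p : QuiverCoord d t → ℂ) :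
    QuiverCoord d t → ℂ
  | .u i hi a => (g i).mulVec (uOf p i hi) a
  | .A i hi a b => (g (i + 1) * AOf p i hi * h i) a b
  | .B i hi a b => (g i * BOf p i hi * h (i + 1)) a b

theorem uOf_actPoint (g h : ∀ i, Matrix (Fin (d i)) (Fin (d i)) ℂ) (p : QuiverCoord d t → ℂ)
    (i : ℕ) (hi : i ≤ t) : uOf (actPoint g h p) i hi = (g i).mulVec (uOf p i hi) := rfl

theorem AOf_actPoint (g h : ∀ i, Matrix (Fin (d i)) (Fin (d i)) ℂ) (p : QuiverCoord d t → ℂ)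
    (i : ℕ) (hi : i < t) : AOf (actPoint g h p) i hi = g (i + 1) * AOf p i hi * h i := rfl

theorem BOf_actPoint (g h : ∀ i, Matrix (Fin (d i)) (Fin (d i)) ℂ) (p : QuiverCoord d t → ℂ)
    (i : ℕ) (hi : i < t) : BOf (actPoint g h p) i hi = g i * BOf p i hi * h (i + 1) := rfl

theorem actPoint_mem {r : ℕ → ℕ} {I : Finset ℕ}
    {g h : ∀ i, Matrix (Fin (dimU r i)) (Fin (dimU r i)) ℂ} (hg : ∀ i, h i * g i = 1)
    {p : QuiverCoord (dimU r) t → ℂ} (hp : p ∈ quiverVariety r t I) :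
    actPoint g h p ∈ quiverVariety r t I := by
  have cancel : ∀ (i : ℕ) {k l : Type} [Fintype k] (M : Matrix k (Fin (dimU r i)) ℂ)
      (N : Matrix (Fin (dimU r i)) l ℂ), M * h i * (g i * N) = M * N := fun i k l _ M N => by
    rw [Matrix.mul_assoc, ← Matrix.mul_assoc (h i), hg, Matrix.one_mul]
  have cancelVec : ∀ (i : ℕ) {k : Type} [Fintype k] (M : Matrix k (Fin (dimU r i)) ℂ)
      (v : Fin (dimU r i) → ℂ), (M * h i).mulVec ((g i).mulVec v) = M.mulVec v :=
    fun i k _ M v => by rw [Matrix.mulVec_mulVec, Matrix.mul_assoc, hg, Matrix.mul_one]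
  refine ⟨fun i hi => ?_, fun i hi hI => ?_, fun i hi hI => ?_⟩
  · simp only [AOf_actPoint, BOf_actPoint]
    rw [Matrix.mul_assoc (g (i + 1 + 1)), cancel, Matrix.mul_assoc (g i), cancel]
    rw [Matrix.mul_assoc (g (i + 1)), ← Matrix.mul_assoc (BOf p _ _), hp.1 i hi]
    simp only [Matrix.mul_assoc]
  · rw [BOf_actPoint, uOf_actPoint, uOf_actPoint, cancelVec, ← Matrix.mulVec_mulVec, hp.2.1 i hi hI]
  · rw [AOf_actPoint, uOf_actPoint, uOf_actPoint, cancelVec, ← Matrix.mulVec_mulVec, hp.2.2 i hi hI]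

/-- The derivation of the polynomial ring that is the differential of `actPoint` in the direction of
a tuple `E` of endomorphisms of the `U_i`. -/
def actDerivation (t : ℕ) (E : ∀ i, Matrix (Fin (d i)) (Fin (d i)) ℂ) :
    Derivation ℂ (MvPolynomial (QuiverCoord d t) ℂ) (MvPolynomial (QuiverCoord d t) ℂ) :=
  mkDerivation ℂ fun
    | .u i hi a => ∑ k, C (E i a k) * X (.u i hi k)
    | .A i hi a b => ∑ k, C (E (i + 1) a k) * X (.A i hi k b) - ∑ k, X (.A i hi a k) * C (E i k b)
    | .B i hi a b => ∑ k, C (E i a k) * X (.B i hi k b) - ∑ k, X (.B i hi a k) * C (E (i + 1) k b)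

theorem hasDerivAt_conj {a b : ℕ} (M : Matrix (Fin a) (Fin b) ℂ) (E : Matrix (Fin a) (Fin a) ℂ)
    (E' : Matrix (Fin b) (Fin b) ℂ) (δ : ℂ) (i : Fin a) (j : Fin b) :
    HasDerivAt (fun z : ℂ => ((1 + z • E) * M * (1 - (z / (1 + δ * z)) • E') : Matrix _ _ ℂ) i j)
      ((E * M - M * E') i j) 0 := by
  have h1 : HasDerivAt (fun z : ℂ => z / (1 + δ * z)) 1 0 := by
    refine ((hasDerivAt_id (0 : ℂ)).fun_div
      (((hasDerivAt_id (0 : ℂ)).const_mul δ).const_add 1) (by simp)).congr_deriv ?_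
    simp
  have h2 : (fun z : ℂ => ((1 + z • E) * M * (1 - (z / (1 + δ * z)) • E') : Matrix _ _ ℂ) i j) = fun z =>
      M i j + z * (E * M) i j - z / (1 + δ * z) * ((M * E') i j + z * (E * M * E') i j) := by
    funext z
    simp only [Matrix.add_mul, Matrix.mul_sub, Matrix.one_mul, Matrix.mul_one, Matrix.smul_mul,
      Matrix.mul_smul, Matrix.add_apply, Matrix.sub_apply, Matrix.smul_apply, smul_eq_mul]
  rw [h2]
  have h3 := (((hasDerivAt_id (0 : ℂ)).mul_const ((E * M) i j)).const_add (M i j)).sub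
    (h1.mul (((hasDerivAt_id (0 : ℂ)).mul_const ((E * M * E') i j)).const_add ((M * E') i j)))
  refine h3.congr_deriv ?_
  simp

theorem aeval_actDerivation_u (E : ∀ i, Matrix (Fin (d i)) (Fin (d i)) ℂ)
    (p : QuiverCoord d t → ℂ) (i : ℕ) (hi : i ≤ t) (a : Fin (d i)) :
    aeval p (actDerivation t E (X (.u i hi a))) = (E i).mulVec (uOf p i hi) a := by
  simp [actDerivation, mkDerivation_X, Matrix.mulVec, dotProduct, uOf]

theorem aeval_actDerivation_A (E : ∀ i, Matrix (Fin (d i)) (Fin (d i)) ℂ)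
    (p : QuiverCoord d t → ℂ) (i : ℕ) (hi : i < t) (a : Fin (d (i + 1))) (b : Fin (d i)) :
    aeval p (actDerivation t E (X (.A i hi a b))) =
      (E (i + 1) * AOf p i hi - AOf p i hi * E i) a b := by
  simp [actDerivation, mkDerivation_X, Matrix.mul_apply, AOf]

theorem aeval_actDerivation_B (E : ∀ i, Matrix (Fin (d i)) (Fin (d i)) ℂ)
    (p : QuiverCoord d t → ℂ) (i : ℕ) (hi : i < t) (a : Fin (d i)) (b : Fin (d (i + 1))) :
    aeval p (actDerivation t E (X (.B i hi a b))) =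
      (E i * BOf p i hi - BOf p i hi * E (i + 1)) a b := by
  simp [actDerivation, mkDerivation_X, Matrix.mul_apply, BOf]

theorem actDerivation_mem {r : ℕ → ℕ} {I : Finset ℕ}
    {E : ∀ i, Matrix (Fin (dimU r i)) (Fin (dimU r i)) ℂ} {δ : ℂ} (hE : ∀ i, E i * E i = δ • E i)
    {F : MvPolynomial (QuiverCoord (dimU r) t) ℂ}
    (hF : F ∈ vanishingIdeal ℂ (quiverVariety r t I)) :
    actDerivation t E F ∈ vanishingIdeal ℂ (quiverVariety r t I) := by
  refine derivation_mem_vanishingIdeal (fun p hp => ?_) hF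
  -- The curve `(1 + z E) · p`; as `E² = δ E`, the inverse of `1 + z E` is `1 - z / (1 + δ z) E`.
  refine ⟨fun z => actPoint (fun i => 1 + z • E i) (fun i => 1 - (z / (1 + δ * z)) • E i) p,
    ?_, ?_, ?_⟩
  · funext c
    cases c <;> simp [actPoint, uOf, AOf, BOf]
  · have : ∀ᶠ z : ℂ in nhds 0, 1 + δ * z ≠ 0 := by
      refine ContinuousAt.eventually_ne (by fun_prop) (by simp)
    filter_upwards [this] with z hz
    refine actPoint_mem (fun i => ?_) hp
    simp only [Matrix.sub_mul, Matrix.mul_add, Matrix.one_mul, Matrix.mul_one, Matrix.smul_mul,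
      Matrix.mul_smul, hE, smul_smul]
    rw [← sub_eq_zero]
    have : z - z / (1 + δ * z) - z * (z / (1 + δ * z)) * δ = 0 := by
      rw [sub_sub, ← mul_div_assoc, ← mul_div_right_comm, ← add_div, sub_eq_zero, eq_div_iff hz]
      ring
    calc _ = (z - z / (1 + δ * z) - z * (z / (1 + δ * z)) * δ) • E i := by module
      _ = 0 := by rw [this, zero_smul]
  · rintro (⟨i, hi, a⟩ | ⟨i, hi, a, b⟩ | ⟨i, hi, a, b⟩)
    · have h2 : (fun z : ℂ => (1 + z • E i).mulVec (uOf p i hi) a) = fun z =>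
          uOf p i hi a + z * (E i).mulVec (uOf p i hi) a := by
        funext z
        simp [Matrix.add_mulVec, Matrix.smul_mulVec]
      simp only [actPoint]
      rw [h2]
      rw [aeval_actDerivation_u]
      refine (((hasDerivAt_id (0 : ℂ)).mul_const ((E i).mulVec (uOf p i hi) a)).const_add
        (uOf p i hi a)).congr_deriv ?_
      rw [one_mul]
    · rw [aeval_actDerivation_A]
      exact hasDerivAt_conj (AOf p i hi) (E (i + 1)) (E i) δ a b
    · rw [aeval_actDerivation_B]
      exact hasDerivAt_conj (BOf p i hi) (E i) (E (i + 1)) δ a b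

end Action

/-! ### The projection to pairs and its invariants -/

section Projection

variable {d : ℕ → ℕ} {s : ℕ}

/-- The map `(u_i, A_i, B_i) ↦ (u_t, A_{t-1} B_{t-1})`, where `t = s + 1`. -/
def projPoint (p : QuiverCoord d (s + 1) → ℂ) : PairCoord (d (s + 1)) → ℂ
  | .v a => p (.u (s + 1) le_rfl a)
  | .x a b => (AOf p s s.lt_succ_self * BOf p s s.lt_succ_self) a b

/-- The comorphism of `projPoint`. -/
def projHom (d : ℕ → ℕ) (s : ℕ) :
    MvPolynomial (PairCoord (d (s + 1))) ℂ →ₐ[ℂ] MvPolynomial (QuiverCoord d (s + 1)) ℂ :=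
  aeval fun
    | .v a => X (.u (s + 1) le_rfl a)
    | .x a b => ∑ k, X (.A s s.lt_succ_self a k) * X (.B s s.lt_succ_self k b)

theorem aeval_projHom (p : QuiverCoord d (s + 1) → ℂ) (F : MvPolynomial (PairCoord (d (s + 1))) ℂ) :
    aeval p (projHom d s F) = aeval (projPoint p) F := by
  rw [← AlgHom.comp_apply]
  congr 1
  ext (a | ⟨a, b⟩)
  · simp [projHom, projPoint]
  · simp [projHom, projPoint, Matrix.mul_apply, AOf, BOf]

theorem vecOf_projPoint (p : QuiverCoord d (s + 1) → ℂ) :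
    vecOf (projPoint p) = uOf p (s + 1) le_rfl := rfl

theorem endOf_projPoint (p : QuiverCoord d (s + 1) → ℂ) :
    endOf (projPoint p) = AOf p s s.lt_succ_self * BOf p s s.lt_succ_self := rfl

instance (t : ℕ) : Finite (QuiverCoord d t) := by
  refine Finite.of_surjective (α := (Σ i : Fin (t + 1), Fin (d i)) ⊕
    (Σ i : Fin t, Fin (d (i + 1)) × Fin (d i)) ⊕ (Σ i : Fin t, Fin (d i) × Fin (d (i + 1))))
    (Sum.elim (fun c => .u c.1 (Nat.lt_succ_iff.1 c.1.2) c.2) (Sum.elim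
      (fun c => .A c.1 c.1.2 c.2.1 c.2.2) fun c => .B c.1 c.1.2 c.2.1 c.2.2)) ?_
  rintro (⟨i, hi, a⟩ | ⟨i, hi, a, b⟩ | ⟨i, hi, a, b⟩)
  · exact ⟨.inl ⟨⟨i, Nat.lt_succ_iff.2 hi⟩, a⟩, rfl⟩
  · exact ⟨.inr (.inl ⟨⟨i, hi⟩, a, b⟩), rfl⟩
  · exact ⟨.inr (.inr ⟨⟨i, hi⟩, a, b⟩), rfl⟩

/-- The index `i` of the coordinates of `u_i`, `A_i` and `B_i`. -/
def QuiverCoord.level {t : ℕ} : QuiverCoord d t → ℕ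
  | .u i _ _ => i
  | .A i _ _ _ => i
  | .B i _ _ _ => i

variable (V : Set (QuiverCoord d (s + 1) → ℂ))

/-- The entries of `A_i` as regular functions. -/
def coordA (i : ℕ) (hi : i < s + 1) : Matrix (Fin (d (i + 1))) (Fin (d i)) (CoordinateRing V) :=
  Matrix.of fun a b => coord V (.A i hi a b)

/-- The entries of `B_i` as regular functions. -/
def coordB (i : ℕ) (hi : i < s + 1) : Matrix (Fin (d i)) (Fin (d (i + 1))) (CoordinateRing V) :=
  Matrix.of fun a b => coord V (.B i hi a b)

/-- The entries of `u_i` as regular functions. -/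
def coordU (i : ℕ) (hi : i ≤ s + 1) : Fin (d i) → CoordinateRing V :=
  fun a => coord V (.u i hi a)

/-- The coordinates of level at least `i` together with the entries of `A_s B_s`. -/
def levelSet (i : ℕ) : Set (CoordinateRing V) :=
  (coord V '' {c | i ≤ c.level}) ∪
    Set.range fun ab : Fin (d (s + 1)) × Fin (d (s + 1)) =>
      (coordA V s s.lt_succ_self * coordB V s s.lt_succ_self) ab.1 ab.2

theorem levelSet_finite (i : ℕ) : (levelSet V i).Finite :=
  ((Set.toFinite _).image _).union (Set.finite_range _)

variable {V}

@[simp]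
theorem evalPoint_coordU (p : V) (i : ℕ) (hi : i ≤ s + 1) (a : Fin (d i)) :
    evalPoint p (coordU V i hi a) = uOf p.1 i hi a := evalPoint_coord _ _

@[simp]
theorem evalPoint_coordA (p : V) (i : ℕ) (hi : i < s + 1) (a : Fin (d (i + 1))) (b : Fin (d i)) :
    evalPoint p (coordA V i hi a b) = AOf p.1 i hi a b := evalPoint_coord _ _

@[simp]
theorem evalPoint_coordB (p : V) (i : ℕ) (hi : i < s + 1) (a : Fin (d i)) (b : Fin (d (i + 1))) :
    evalPoint p (coordB V i hi a b) = BOf p.1 i hi a b := evalPoint_coord _ _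

theorem coord_mem_adjoin {i : ℕ} {c : QuiverCoord d (s + 1)} (hc : i ≤ c.level) :
    coord V c ∈ Algebra.adjoin ℂ (levelSet V i) :=
  Algebra.subset_adjoin (.inl ⟨c, hc, rfl⟩)

end Projection

section Levels

variable {r : ℕ → ℕ} {s : ℕ} {I : Finset ℕ}

local notation "𝓥" => quiverVariety r (s + 1) I

/-- The entries of `A_i B_i` can be expressed in the coordinates of level above `i` and the entries
of `A_s B_s`. -/
theorem coordA_mul_coordB_mem (i : ℕ) (hi : i < s + 1) (a b : Fin (dimU r (i + 1))) :
    (coordA 𝓥 i hi * coordB 𝓥 i hi) a b ∈ Algebra.adjoin ℂ (levelSet 𝓥 (i + 1)) := by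
  rcases Nat.lt_succ_iff_lt_or_eq.1 hi with h | rfl
  · have : (coordA 𝓥 i hi * coordB 𝓥 i hi) a b =
        (coordB 𝓥 (i + 1) (by omega) * coordA 𝓥 (i + 1) (by omega)) a b := by
      refine coordinateRing_ext fun p => ?_
      have := congrFun (congrFun (p.2.1 i (by omega)) a) b
      simpa [Matrix.mul_apply] using this.symm
    rw [this, Matrix.mul_apply]
    exact sum_mem fun k _ => mul_mem (coord_mem_adjoin le_rfl) (coord_mem_adjoin le_rfl)
  · exact Algebra.subset_adjoin (.inr ⟨(a, b), rfl⟩)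

/-- The entries of `A_i u_i` can be expressed in the coordinates of level above `i` and the entries
of `A_s B_s`. -/
theorem coordA_mulVec_coordU_mem (i : ℕ) (hi : i < s + 1) (a : Fin (dimU r (i + 1))) :
    (coordA 𝓥 i hi).mulVec (coordU 𝓥 i hi.le) a ∈ Algebra.adjoin ℂ (levelSet 𝓥 (i + 1)) := by
  by_cases hI : i ∈ I
  · have : (coordA 𝓥 i hi).mulVec (coordU 𝓥 i hi.le) a =
        (coordA 𝓥 i hi * coordB 𝓥 i hi).mulVec (coordU 𝓥 (i + 1) hi) a := by
      refine coordinateRing_ext fun p => ?_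
      have := congrFun (congrArg ((AOf p.1 i hi).mulVec) (p.2.2.1 i hi hI)) a
      rw [Matrix.mulVec_mulVec] at this
      simpa [Matrix.mulVec, dotProduct, Matrix.mul_apply] using this.symm
    rw [this, Matrix.mulVec, dotProduct]
    exact sum_mem fun k _ => mul_mem (coordA_mul_coordB_mem i hi a k)
      (coord_mem_adjoin (c := .u (i + 1) hi k) le_rfl)
  · have : (coordA 𝓥 i hi).mulVec (coordU 𝓥 i hi.le) a = coordU 𝓥 (i + 1) hi a := by
      refine coordinateRing_ext fun p => ?_
      simpa [Matrix.mulVec, dotProduct] using congrFun (p.2.2.2 i hi hI) a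
    rw [this]
    exact coord_mem_adjoin le_rfl

/-- The derivation of the coordinate ring of the quiver variety by which a tuple of endomorphisms of
the `U_i` acts. -/
def quotDerivation {E : ∀ i, Matrix (Fin (dimU r i)) (Fin (dimU r i)) ℂ} {δ : ℂ}
    (hE : ∀ i, E i * E i = δ • E i) : Derivation ℂ (CoordinateRing 𝓥) (CoordinateRing 𝓥) :=
  quotientDerivation _ (actDerivation (s + 1) E) fun _ => actDerivation_mem hE

theorem evalPoint_quotDerivation {E : ∀ i, Matrix (Fin (dimU r i)) (Fin (dimU r i)) ℂ} {δ : ℂ}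
    (hE : ∀ i, E i * E i = δ • E i) (p : 𝓥) (F : MvPolynomial (QuiverCoord (dimU r) (s + 1)) ℂ) :
    evalPoint p (quotDerivation hE (toCoordinateRing 𝓥 F)) =
      aeval (p : _ → ℂ) (actDerivation (s + 1) E F) :=
  congrArg (evalPoint p) (quotientDerivation_mk _ _ _ F)

section

variable {E : ∀ i, Matrix (Fin (dimU r i)) (Fin (dimU r i)) ℂ} {δ : ℂ}
  (hE : ∀ i, E i * E i = δ • E i)

theorem quotDerivation_coordU (i : ℕ) (hi : i ≤ s + 1) (a : Fin (dimU r i)) :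
    quotDerivation hE (coordU 𝓥 i hi a) =
      ((E i).map (algebraMap ℂ (CoordinateRing 𝓥))).mulVec (coordU 𝓥 i hi) a := by
  refine coordinateRing_ext fun p => ?_
  rw [coordU, coord, evalPoint_quotDerivation, aeval_actDerivation_u]
  simp [Matrix.mulVec, dotProduct]

theorem quotDerivation_coordA (i : ℕ) (hi : i < s + 1) (a : Fin (dimU r (i + 1)))
    (b : Fin (dimU r i)) :
    quotDerivation hE (coordA 𝓥 i hi a b) =
      ((E (i + 1)).map (algebraMap ℂ (CoordinateRing 𝓥)) * coordA 𝓥 i hi -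
        coordA 𝓥 i hi * (E i).map (algebraMap ℂ (CoordinateRing 𝓥))) a b := by
  refine coordinateRing_ext fun p => ?_
  rw [coordA, Matrix.of_apply, coord, evalPoint_quotDerivation, aeval_actDerivation_A]
  simp [Matrix.mul_apply, AOf]

theorem quotDerivation_coordB (i : ℕ) (hi : i < s + 1) (a : Fin (dimU r i))
    (b : Fin (dimU r (i + 1))) :
    quotDerivation hE (coordB 𝓥 i hi a b) =
      ((E i).map (algebraMap ℂ (CoordinateRing 𝓥)) * coordB 𝓥 i hi -
        coordB 𝓥 i hi * (E (i + 1)).map (algebraMap ℂ (CoordinateRing 𝓥))) a b := by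
  refine coordinateRing_ext fun p => ?_
  rw [coordB, Matrix.of_apply, coord, evalPoint_quotDerivation, aeval_actDerivation_B]
  simp [Matrix.mul_apply, BOf]

/-- Endomorphisms of the `U_i` with `i < t` annihilate the entries of `A_{t-1} B_{t-1}`. -/
theorem quotDerivation_mul (hs : E (s + 1) = 0) (a b : Fin (dimU r (s + 1))) :
    quotDerivation hE ((coordA 𝓥 s s.lt_succ_self * coordB 𝓥 s s.lt_succ_self) a b) = 0 := by
  rw [Matrix.mul_apply, map_sum]
  simp only [Derivation.leibniz, quotDerivation_coordA, quotDerivation_coordB, hs, smul_eq_mul]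
  set A := coordA 𝓥 s s.lt_succ_self
  set B := coordB 𝓥 s s.lt_succ_self
  set M := (E s).map (algebraMap ℂ (CoordinateRing 𝓥))
  have h : (A * (M * B)) a b - (A * M * B) a b = 0 := by rw [Matrix.mul_assoc, sub_self]
  rw [← h, Matrix.mul_apply, Matrix.mul_apply, ← Finset.sum_sub_distrib]
  refine Finset.sum_congr rfl fun k _ => ?_
  simp only [Matrix.map_zero _ (map_zero _), Matrix.zero_mul, Matrix.mul_zero, zero_sub, sub_zero,
    Matrix.neg_apply]
  ring

end

/-- Eliminating the coordinates of level `i` from a `𝔤𝔩(U_i)`-invariant: by the first fundamental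
theorem only the entries of `A_i B_i` and `A_i u_i` remain. -/
theorem mem_adjoin_levelSet_succ {i : ℕ} (hi : i < s + 1) {f : CoordinateRing 𝓥}
    (hf : ∀ (E : ∀ i, Matrix (Fin (dimU r i)) (Fin (dimU r i)) ℂ) (δ : ℂ)
      (hE : ∀ i, E i * E i = δ • E i), E (s + 1) = 0 → quotDerivation hE f = 0)
    (hfi : f ∈ Algebra.adjoin ℂ (levelSet 𝓥 i)) :
    f ∈ Algebra.adjoin ℂ (levelSet 𝓥 (i + 1)) := by
  let E : Fin (dimU r i) → Fin (dimU r i) → ∀ j, Matrix (Fin (dimU r j)) (Fin (dimU r j)) ℂ :=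
    fun a b => Pi.single i (Matrix.single a b 1)
  have hEi : ∀ a b, E a b i = Matrix.single a b 1 := fun a b => Pi.single_eq_same _ _
  have hEj : ∀ a b j, j ≠ i → E a b j = 0 := fun a b j hj => Pi.single_eq_of_ne hj _
  have hE : ∀ a b j, E a b j * E a b j = (if a = b then 1 else 0 : ℂ) • E a b j := by
    intro a b j
    by_cases hj : j = i
    · subst hj
      rw [hEi]
      by_cases hab : a = b
      · subst hab
        simp
      · rw [if_neg hab, zero_smul, Matrix.single_mul_single_of_ne _ _ _ _ (Ne.symm hab)]
    · rw [hEj a b j hj, smul_zero, mul_zero]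
  let B : Matrix (Fin (dimU r i)) (Fin (dimU r (i + 1)) ⊕ Unit) (CoordinateRing 𝓥) :=
    Matrix.of fun a => Sum.elim (coordB 𝓥 i hi a) fun _ => coordU 𝓥 i hi.le a
  have key := mem_adjoin_of_invariant (fun a b => quotDerivation (hE a b)) (coordA 𝓥 i hi) B
    (levelSet_finite 𝓥 (i + 1)) ?_ ?_ ?_ (f := f) ?_ fun a b =>
      hf _ _ (hE a b) (hEj a b _ (by omega))
  · refine (Algebra.adjoin_le ?_ : Algebra.adjoin ℂ _ ≤ Algebra.adjoin ℂ (levelSet 𝓥 (i + 1))) key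
    rintro _ (⟨⟨a, b | _⟩, rfl⟩ | hy)
    · exact coordA_mul_coordB_mem i hi a b
    · exact coordA_mulVec_coordU_mem i hi a
    · exact Algebra.subset_adjoin hy
  · intro a b k l
    rw [quotDerivation_coordA, hEi, hEj _ _ (i + 1) (by omega)]
    by_cases hl : l = b
    · subst hl
      simp [Matrix.map_single]
    · simp [Matrix.map_single, hl]
  · rintro a b k (l | l)
    · change quotDerivation _ (coordB 𝓥 i hi k l) = if k = a then coordB 𝓥 i hi b l else 0
      rw [quotDerivation_coordB, hEi, hEj _ _ (i + 1) (by omega)]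
      by_cases hk : k = a
      · subst hk
        simp [Matrix.map_single]
      · simp [Matrix.map_single, hk]
    · change quotDerivation _ (coordU 𝓥 i hi.le k) = if k = a then coordU 𝓥 i hi.le b else 0
      rw [quotDerivation_coordU, hEi]
      by_cases hk : k = a
      · subst hk
        simp [Matrix.map_single, Matrix.single_mulVec]
      · simp [Matrix.map_single, Matrix.single_mulVec, hk]
  · rintro a b y (⟨c, hc, rfl⟩ | ⟨ab, rfl⟩)
    · rcases c with ⟨j, hj, k⟩ | ⟨j, hj, k, l⟩ | ⟨j, hj, k, l⟩ <;>
        replace hc : i + 1 ≤ j := hc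
      · change quotDerivation _ (coordU 𝓥 j hj k) = 0
        rw [quotDerivation_coordU, hEj _ _ j (by omega)]
        simp
      · change quotDerivation _ (coordA 𝓥 j hj k l) = 0
        rw [quotDerivation_coordA, hEj _ _ j (by omega), hEj _ _ (j + 1) (by omega)]
        simp
      · change quotDerivation _ (coordB 𝓥 j hj k l) = 0
        rw [quotDerivation_coordB, hEj _ _ j (by omega), hEj _ _ (j + 1) (by omega)]
        simp
    · exact quotDerivation_mul _ (hEj _ _ _ (by omega)) _ _
  · refine (Algebra.adjoin_mono ?_ : _ ≤ _) hfi
    rintro _ (⟨c, hc, rfl⟩ | hy)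
    · by_cases hci : i + 1 ≤ c.level
      · exact .inr (.inl ⟨c, hci, rfl⟩)
      have hci : c.level = i := le_antisymm (by omega) hc
      rcases c with ⟨j, hj, k⟩ | ⟨j, hj, k, l⟩ | ⟨j, hj, k, l⟩ <;> obtain rfl : j = i := hci
      · exact .inl (.inr ⟨(k, .inr ()), rfl⟩)
      · exact .inl (.inl ⟨(k, l), rfl⟩)
      · exact .inl (.inr ⟨(k, .inl l), rfl⟩)
    · exact .inr (.inr hy)

/-- A regular function on the quiver variety that is invariant under `𝔤𝔩(U_i)` for all `i < t` is a
polynomial in the entries of `u_t` and `A_{t-1} B_{t-1}`. -/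
theorem mem_range_of_invariant {f : CoordinateRing 𝓥}
    (hf : ∀ (E : ∀ i, Matrix (Fin (dimU r i)) (Fin (dimU r i)) ℂ) (δ : ℂ)
      (hE : ∀ i, E i * E i = δ • E i), E (s + 1) = 0 → quotDerivation hE f = 0) :
    ∃ F, toCoordinateRing 𝓥 (projHom (dimU r) s F) = f := by
  have h : ∀ i ≤ s + 1, f ∈ Algebra.adjoin ℂ (levelSet 𝓥 i) := by
    intro i
    induction i with
    | zero =>
      intro _
      have : f ∈ Algebra.adjoin ℂ (Set.range (coord 𝓥)) := by
        rw [adjoin_coord]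
        exact Algebra.mem_top
      refine Algebra.adjoin_mono ?_ this
      rintro _ ⟨c, rfl⟩
      exact .inl ⟨c, Nat.zero_le _, rfl⟩
    | succ i ih => exact fun hi => mem_adjoin_levelSet_succ hi hf (ih (by omega))
  refine (Algebra.adjoin_le ?_ : Algebra.adjoin ℂ _ ≤
    ((toCoordinateRing 𝓥).comp (projHom (dimU r) s)).range) (h (s + 1) le_rfl)
  rintro _ (⟨c, hc, rfl⟩ | ⟨⟨a, b⟩, rfl⟩)
  · rcases c with ⟨j, hj, k⟩ | ⟨j, hj, k, l⟩ | ⟨j, hj, k, l⟩ <;> replace hc : s + 1 ≤ j := hc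
    · obtain rfl : j = s + 1 := le_antisymm hj hc
      exact ⟨X (.v k), by simp [projHom, coord]⟩
    · omega
    · omega
  · refine ⟨X (.x a b), ?_⟩
    change toCoordinateRing 𝓥 (projHom (dimU r) s (X (.x a b))) =
      (coordA 𝓥 s s.lt_succ_self * coordB 𝓥 s s.lt_succ_self) a b
    rw [projHom, aeval_X, map_sum, Matrix.mul_apply]
    exact Finset.sum_congr rfl fun k _ => map_mul _ _ _

theorem quotDerivation_proj {E : ∀ i, Matrix (Fin (dimU r i)) (Fin (dimU r i)) ℂ} {δ : ℂ}
    (hE : ∀ i, E i * E i = δ • E i) (hs : E (s + 1) = 0)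
    (F : MvPolynomial (PairCoord (dimU r (s + 1))) ℂ) :
    quotDerivation hE (toCoordinateRing 𝓥 (projHom (dimU r) s F)) = 0 := by
  induction F using MvPolynomial.induction_on with
  | C a => rw [← algebraMap_eq, AlgHom.commutes, AlgHom.commutes, Derivation.map_algebraMap]
  | add F G hF hG => rw [map_add, map_add, map_add, hF, hG, add_zero]
  | mul_X F c hF =>
    rw [map_mul, map_mul, Derivation.leibniz, hF, smul_zero, add_zero]
    have : quotDerivation hE (toCoordinateRing 𝓥 (projHom (dimU r) s (X c))) = 0 := by
      rcases c with a | ⟨a, b⟩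
      · have := quotDerivation_coordU (I := I) hE (s + 1) le_rfl a
        rw [hs] at this
        simpa [projHom, coordU, coord] using this
      · rw [← quotDerivation_mul (I := I) hE hs a b, projHom, aeval_X, map_sum, Matrix.mul_apply]
        rfl
    rw [this, smul_zero]

/-- If the quotient of two functions of `(u_t, A_{t-1} B_{t-1})` is a regular function on the
(irreducible) quiver variety, then this function is a polynomial in `(u_t, A_{t-1} B_{t-1})`. -/
theorem exists_proj_eq_of_mul_eq [IsDomain (CoordinateRing 𝓥)] {f : CoordinateRing 𝓥}
    {F G : MvPolynomial (PairCoord (dimU r (s + 1))) ℂ}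
    (hG : toCoordinateRing 𝓥 (projHom (dimU r) s G) ≠ 0)
    (h : toCoordinateRing 𝓥 (projHom (dimU r) s G) * f =
      toCoordinateRing 𝓥 (projHom (dimU r) s F)) :
    ∃ H, toCoordinateRing 𝓥 (projHom (dimU r) s H) = f := by
  refine mem_range_of_invariant fun E δ hE hs => ?_
  have h1 := congrArg (quotDerivation hE) h
  rw [Derivation.leibniz, quotDerivation_proj hE hs, quotDerivation_proj hE hs, smul_zero, add_zero,
    smul_eq_mul] at h1
  exact (mul_eq_zero.1 h1).resolve_left hG

end Levels

/-! ### Normality -/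

section Normality

variable {σ : Type} {V : Set (σ → ℂ)}

/-- The coordinate ring of a cone (for positive weights `w`) embeds into its local ring at the
vertex: if `s f = 0` and `s` does not vanish at the vertex, then restriction to the curves
`z ↦ z · p` shows that `f` vanishes at every point `p`. -/
theorem eq_zero_of_mul_eq_zero_of_cone {w : σ → ℕ} (hw : ∀ c, 0 < w c)
    (hV : ∀ p ∈ V, ∀ z : ℂ, (fun c => z ^ w c * p c) ∈ V) {F G : MvPolynomial σ ℂ}
    (hG : aeval (0 : σ → ℂ) G ≠ 0) (h : toCoordinateRing V (G * F) = 0) :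
    toCoordinateRing V F = 0 := by
  rw [toCoordinateRing_eq_zero] at h ⊢
  intro p hp
  let Φ : MvPolynomial σ ℂ →ₐ[ℂ] Polynomial ℂ :=
    aeval fun c => Polynomial.X ^ w c * Polynomial.C (p c)
  have hΦ : ∀ z H, (Φ H).eval z = aeval (fun c => z ^ w c * p c) H := by
    intro z H
    have : (Polynomial.aeval z).comp Φ = aeval (fun c => z ^ w c * p c) := by
      ext c
      simp only [Φ, AlgHom.comp_apply, aeval_X, map_mul, map_pow, Polynomial.aeval_X, Polynomial.aeval_C]
      rfl
    rw [← this, AlgHom.comp_apply, Polynomial.coe_aeval_eq_eval]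
  have h0 : Φ G * Φ F = 0 := by
    rw [← map_mul]
    refine Polynomial.funext fun z => ?_
    rw [hΦ, h _ (hV p hp z), Polynomial.eval_zero]
  have hG0 : Φ G ≠ 0 := fun h1 => hG (by
    have := hΦ 0 G
    rw [h1, Polynomial.eval_zero] at this
    rw [this]
    congr 2
    funext c
    simp [(hw c).ne'])
  have := hΦ 1 F
  rw [(mul_eq_zero.1 h0).resolve_left hG0, Polynomial.eval_zero] at this
  simpa using this.symm

/-- A normal cone is irreducible. -/
theorem isDomain_of_cone {w : σ → ℕ} (hw : ∀ c, 0 < w c)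
    (hV : ∀ p ∈ V, ∀ z : ℂ, (fun c => z ^ w c * p c) ∈ V) (h0 : (0 : σ → ℂ) ∈ V)
    (hn : IsNormalVariety V) : IsDomain (CoordinateRing V) := by
  let 𝔭 : Ideal (CoordinateRing V) := RingHom.ker (evalPoint ⟨0, h0⟩)
  have : 𝔭.IsPrime := RingHom.ker_isPrime _
  have := (hn 𝔭).1
  refine Function.Injective.isDomain (algebraMap (CoordinateRing V) (Localization.AtPrime 𝔭)) ?_
  rw [injective_iff_map_eq_zero]
  intro f hf
  obtain ⟨⟨g, hg⟩, hgf⟩ := (IsLocalization.map_eq_zero_iff 𝔭.primeCompl _ f).1 hf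
  obtain ⟨F, rfl⟩ := toCoordinateRing_surjective V f
  obtain ⟨G, rfl⟩ := toCoordinateRing_surjective V g
  exact eq_zero_of_mul_eq_zero_of_cone hw hV (fun h => hg h) ((map_mul _ _ _).trans hgf)

theorem IsNormalVariety.isIntegrallyClosed [IsDomain (CoordinateRing V)] (hn : IsNormalVariety V) :
    IsIntegrallyClosed (CoordinateRing V) :=
  IsIntegrallyClosed.of_localization_maximal fun p _ _ => (hn p).2

theorem IsNormalVariety.of_isIntegrallyClosed [IsDomain (CoordinateRing V)]
    [IsIntegrallyClosed (CoordinateRing V)] : IsNormalVariety V := fun p _ =>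
  ⟨IsLocalization.isDomain_localization p.primeCompl_le_nonZeroDivisors,
    isIntegrallyClosed_of_isLocalization _ p.primeCompl p.primeCompl_le_nonZeroDivisors⟩

theorem vanishingIdeal_zariskiClosure (V : Set (σ → ℂ)) :
    vanishingIdeal ℂ (zariskiClosure V) = vanishingIdeal ℂ V :=
  le_antisymm (vanishingIdeal_anti_mono (zeroLocus_vanishingIdeal_le V))
    (le_vanishingIdeal_zeroLocus _)

/-- A subring `R` of an integrally closed domain `S` is integrally closed if it contains every
element of `S` that is a fraction of elements of `R`. -/
theorem isIntegrallyClosed_of_injective {R S : Type*} [CommRing R] [CommRing S] [IsDomain R]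
    [IsDomain S] [IsIntegrallyClosed S] (ι : R →+* S) (hι : Function.Injective ι)
    (h : ∀ a b : R, b ≠ 0 → ∀ s : S, ι b * s = ι a → ∃ c, ι c = s) : IsIntegrallyClosed R := by
  rw [isIntegrallyClosed_iff (FractionRing R)]
  intro x hx
  let j : FractionRing R →+* FractionRing S := IsFractionRing.map hι
  have hj : ∀ a, j (algebraMap R _ a) = algebraMap S _ (ι a) := fun a => IsLocalization.map_eq _ a
  obtain ⟨s, hs⟩ := (isIntegrallyClosed_iff (FractionRing S)).1 ‹_›
    (hx.map_of_comp_eq ι j (RingHom.ext fun a => (hj a).symm))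
  obtain ⟨a, b, hb, rfl⟩ := IsFractionRing.div_surjective (A := R) x
  have hb0 : b ≠ 0 := nonZeroDivisors.ne_zero hb
  have hbK : algebraMap R (FractionRing R) b ≠ 0 := by simpa using hb0
  obtain ⟨c, rfl⟩ := h a b hb0 s (by
    apply IsFractionRing.injective S (FractionRing S)
    rw [map_mul, hs, ← hj, ← hj, ← map_mul, mul_div_cancel₀ _ hbK])
  refine ⟨c, ?_⟩
  apply j.injective
  rw [hj, hs]

end Normality

section QuiverNormality

variable {r : ℕ → ℕ} {t : ℕ} {I : Finset ℕ}

/-- Weights of the coordinates for which the quiver variety is a cone. -/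
def coneWeight (I : Finset ℕ) {d : ℕ → ℕ} {t : ℕ} : QuiverCoord d t → ℕ
  | .u i _ _ => 1 + ((Finset.range i).filter (· ∉ I)).card + ((Finset.Ico i t).filter (· ∈ I)).card
  | .A _ _ _ _ => 1
  | .B _ _ _ _ => 1

theorem coneWeight_pos {d : ℕ → ℕ} (c : QuiverCoord d t) : 0 < coneWeight I c := by
  cases c <;> simp only [coneWeight] <;> omega

theorem zero_mem_quiverVariety : (0 : QuiverCoord (dimU r) t → ℂ) ∈ quiverVariety r t I := by
  have hu : ∀ i hi, uOf (0 : QuiverCoord (dimU r) t → ℂ) i hi = 0 := fun i hi => rfl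
  have hA : ∀ i hi, AOf (0 : QuiverCoord (dimU r) t → ℂ) i hi = 0 := fun i hi => rfl
  have hB : ∀ i hi, BOf (0 : QuiverCoord (dimU r) t → ℂ) i hi = 0 := fun i hi => rfl
  refine ⟨fun i hi => ?_, fun i hi _ => ?_, fun i hi _ => ?_⟩ <;> simp [hu, hA, hB]

theorem coneWeight_mem {p : QuiverCoord (dimU r) t → ℂ} (hp : p ∈ quiverVariety r t I) (z : ℂ) :
    (fun c => z ^ coneWeight I c * p c) ∈ quiverVariety r t I := by
  set q : QuiverCoord (dimU r) t → ℂ := fun c => z ^ coneWeight I c * p c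
  let w : ℕ → ℕ := fun i =>
    1 + ((Finset.range i).filter (· ∉ I)).card + ((Finset.Ico i t).filter (· ∈ I)).card
  have hu : ∀ i hi, uOf q i hi = z ^ w i • uOf p i hi := fun i hi => rfl
  have hA : ∀ i hi, AOf q i hi = z • AOf p i hi := fun i hi => by
    ext a b
    simp [q, AOf, coneWeight]
  have hB : ∀ i hi, BOf q i hi = z • BOf p i hi := fun i hi => by
    ext a b
    simp [q, BOf, coneWeight]
  have hwI : ∀ i < t, i ∈ I → w i = w (i + 1) + 1 := fun i hi hI => by
    simp only [w]
    rw [← Finset.insert_Ico_add_one_left_eq_Ico hi, Finset.filter_insert, if_pos hI,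
      Finset.card_insert_of_notMem (by simp), Finset.range_add_one, Finset.filter_insert,
      if_neg (by simpa using hI)]
    omega
  have hwN : ∀ i < t, i ∉ I → w (i + 1) = w i + 1 := fun i hi hI => by
    simp only [w]
    rw [← Finset.insert_Ico_add_one_left_eq_Ico hi, Finset.filter_insert, if_neg hI,
      Finset.range_add_one, Finset.filter_insert, if_pos hI,
      Finset.card_insert_of_notMem (by simp)]
    omega
  refine ⟨fun i hi => ?_, fun i hi hI => ?_, fun i hi hI => ?_⟩
  · simp only [hA, hB, Matrix.smul_mul, Matrix.mul_smul, hp.1 i hi]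
  · rw [hu, hu, hB, Matrix.smul_mulVec, Matrix.mulVec_smul, hp.2.1 i hi hI, smul_smul, hwI i hi hI,
      pow_succ']
  · rw [hu, hu, hA, Matrix.smul_mulVec, Matrix.mulVec_smul, hp.2.2 i hi hI, smul_smul, hwN i hi hI,
      pow_succ']

theorem isDomain_quiverVariety (hn : IsNormalVariety (quiverVariety r t I)) :
    IsDomain (CoordinateRing (quiverVariety r t I)) :=
  isDomain_of_cone coneWeight_pos (fun _ hp z => coneWeight_mem hp z) zero_mem_quiverVariety hn

/-- The closure of a set `O` of pairs is normal if the quiver variety is normal and the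
projection to pairs identifies the regular functions on the closure of `O` with functions on the
quiver variety. -/
theorem isNormalVariety_of_ker {s : ℕ} {O : Set (PairCoord (dimU r (s + 1)) → ℂ)}
    (hn : IsNormalVariety (quiverVariety r (s + 1) I))
    (hker : ∀ F, F ∈ vanishingIdeal ℂ O ↔
      toCoordinateRing (quiverVariety r (s + 1) I) (projHom (dimU r) s F) = 0) :
    IsNormalVariety (zariskiClosure O) := by
  have := isDomain_quiverVariety hn
  have := hn.isIntegrallyClosed
  let φ := (toCoordinateRing (quiverVariety r (s + 1) I)).comp (projHom (dimU r) s)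
  let ι : CoordinateRing (zariskiClosure O) →ₐ[ℂ] CoordinateRing (quiverVariety r (s + 1) I) :=
    Ideal.Quotient.liftₐ _ φ fun F hF => by
      rw [vanishingIdeal_zariskiClosure] at hF
      exact (hker F).1 hF
  have hι : ∀ F, ι (toCoordinateRing _ F) = φ F := fun F => rfl
  have hinj : Function.Injective ι := by
    rw [injective_iff_map_eq_zero]
    intro x hx
    obtain ⟨F, rfl⟩ := toCoordinateRing_surjective _ x
    refine Ideal.Quotient.eq_zero_iff_mem.2 ?_
    rw [vanishingIdeal_zariskiClosure]
    exact (hker F).2 hx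
  have : IsDomain (CoordinateRing (zariskiClosure O)) := hinj.isDomain ι.toRingHom
  have : IsIntegrallyClosed (CoordinateRing (zariskiClosure O)) := by
    refine isIntegrallyClosed_of_injective ι.toRingHom hinj fun a b hb f hf => ?_
    obtain ⟨F, rfl⟩ := toCoordinateRing_surjective _ a
    obtain ⟨G, rfl⟩ := toCoordinateRing_surjective _ b
    obtain ⟨H, hH⟩ := exists_proj_eq_of_mul_eq (I := I) (F := F) (G := G) (f := f)
      (fun h => hb (hinj ((hι G).trans (h.trans (map_zero ι).symm)))) hf
    exact ⟨toCoordinateRing _ H, hH⟩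
  exact IsNormalVariety.of_isIntegrallyClosed

end QuiverNormality

/-! ### Quiver data with injective `A_i` and surjective `B_i` -/

section Transitivity

/-- A pair of an injection `A : U → W` and a surjection `B : W → U` is determined by `BA` up to
automorphisms of `W`. -/
theorem exists_linearMap_conj {K U W : Type*} [Field K] [AddCommGroup U] [Module K U]
    [AddCommGroup W] [Module K W] [FiniteDimensional K U] [FiniteDimensional K W]
    {A A' : U →ₗ[K] W} {B B' : W →ₗ[K] U} (hA : Function.Injective A) (hA' : Function.Injective A')
    (hB : Function.Surjective B) (hB' : Function.Surjective B') (h : B ∘ₗ A = B' ∘ₗ A') :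
    ∃ g : W →ₗ[K] W, Function.Injective g ∧ g ∘ₗ A = A' ∧ B' ∘ₗ g = B := by
  -- Split `ker B = A (ker BA) ⊕ C` and `W = (im A ⊕ C) ⊕ D`, and likewise `ker B' = A' (ker BA) ⊕ C'`.
  -- On `im A` the map has to be `A' A⁻¹`; on `C` it can be any isomorphism `C ≃ C'`; on `D` any lift
  -- of `B` along `B'`.
  set N := LinearMap.ker (B ∘ₗ A)
  have hN' : N = LinearMap.ker (B' ∘ₗ A') := by rw [← h]
  have split : ∀ {A : U →ₗ[K] W} {B : W →ₗ[K] U}, Function.Injective A →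
      N = LinearMap.ker (B ∘ₗ A) → ∃ C : Submodule K W, (∀ c ∈ C, B c = 0) ∧
        (∀ u, A u ∈ C → u = 0) ∧ (LinearMap.ker B ≤ LinearMap.range A ⊔ C) ∧
        Module.finrank K N + Module.finrank K C = Module.finrank K (LinearMap.ker B) := by
    intro A B hA hN
    have hle : N.map A ≤ LinearMap.ker B := by
      rintro _ ⟨u, hu, rfl⟩
      rw [hN] at hu
      exact hu
    obtain ⟨C, hC⟩ := exists_isCompl (Submodule.comap (LinearMap.ker B).subtype (N.map A))
    refine ⟨C.map (LinearMap.ker B).subtype, ?_, ?_, ?_, ?_⟩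
    · rintro _ ⟨c, _, rfl⟩
      exact c.2
    · rintro u ⟨c, hc, hcu⟩
      have hu : u ∈ N := by
        rw [hN, LinearMap.mem_ker, LinearMap.comp_apply, ← hcu]
        exact c.2
      have : c = 0 := (Submodule.mem_bot K).1 (hC.inf_eq_bot ▸ Submodule.mem_inf.2
        ⟨Submodule.mem_comap.2 ⟨u, hu, hcu.symm⟩, hc⟩)
      rw [this, map_zero] at hcu
      exact hA (hcu.symm.trans (map_zero A).symm)
    · intro w hw
      have : (⟨w, hw⟩ : LinearMap.ker B) ∈
          Submodule.comap (LinearMap.ker B).subtype (N.map A) ⊔ C := by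
        rw [hC.sup_eq_top]
        trivial
      obtain ⟨x, ⟨u, _, hux⟩, c, hc, hxc⟩ := Submodule.mem_sup.1 this
      refine Submodule.mem_sup.2 ⟨A u, ⟨u, rfl⟩, _, ⟨c, hc, rfl⟩, ?_⟩
      rw [hux, ← map_add, hxc]
      rfl
    · rw [← Submodule.finrank_add_eq_of_isCompl hC,
        (Submodule.comapSubtypeEquivOfLe hle).finrank_eq, Submodule.finrank_map_subtype_eq,
        ← (Submodule.equivMapOfInjective A hA N).finrank_eq]
  obtain ⟨C, hC0, hCA, hCle, hCdim⟩ := split hA rfl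
  obtain ⟨C', hC0', hCA', hCle', hCdim'⟩ := split hA' hN'
  have hdim : Module.finrank K C = Module.finrank K C' := by
    have h1 := LinearMap.finrank_range_add_finrank_ker B
    have h2 := LinearMap.finrank_range_add_finrank_ker B'
    rw [LinearMap.range_eq_top.2 hB] at h1
    rw [LinearMap.range_eq_top.2 hB'] at h2
    omega
  let φ : C ≃ₗ[K] C' := LinearEquiv.ofFinrankEq C C' hdim
  obtain ⟨D, hD⟩ := exists_isCompl (LinearMap.range A ⊔ C)
  obtain ⟨σ, hσ⟩ := B'.exists_rightInverse_of_surjective (LinearMap.range_eq_top.2 hB')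
  have hσ' : ∀ u, B' (σ u) = u := fun u => LinearMap.congr_fun hσ u
  let e₀ : (U × C) × D →ₗ[K] W := (A.coprod C.subtype).coprod D.subtype
  let f : (U × C) × D →ₗ[K] W :=
    (A'.coprod (C'.subtype ∘ₗ φ.toLinearMap)).coprod (σ ∘ₗ B ∘ₗ D.subtype)
  have he₀ : ∀ u c d, e₀ ((u, c), d) = A u + c + d := fun u c d => rfl
  have hf : ∀ u c d, f ((u, c), d) = A' u + φ c + σ (B d) := fun u c d => rfl
  have hsep : ∀ (d : D), (d : W) ∈ LinearMap.range A ⊔ C → d = 0 := fun d hd =>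
    Subtype.ext ((Submodule.mem_bot K).1 (hD.inf_eq_bot ▸ Submodule.mem_inf.2 ⟨hd, d.2⟩))
  have hBf : ∀ x, B' (f x) = B (e₀ x) := by
    rintro ⟨⟨u, c⟩, d⟩
    rw [hf, he₀, map_add, map_add, map_add, map_add, hσ', hC0 c c.2, hC0' _ (φ c).2]
    exact congrArg (· + 0 + B d) (LinearMap.congr_fun h.symm u)
  have he_inj : Function.Injective e₀ := by
    rw [injective_iff_map_eq_zero]
    rintro ⟨⟨u, c⟩, d⟩ hx
    rw [he₀] at hx
    obtain rfl : d = 0 := hsep d (by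
      rw [eq_neg_of_add_eq_zero_right hx]
      exact neg_mem (Submodule.add_mem_sup ⟨u, rfl⟩ c.2))
    rw [Submodule.coe_zero, add_zero] at hx
    obtain rfl : u = 0 := hCA u (by
      rw [eq_neg_of_add_eq_zero_left hx]
      exact neg_mem c.2)
    rw [map_zero, zero_add] at hx
    obtain rfl : c = 0 := Subtype.ext hx
    rfl
  have he_surj : Function.Surjective e₀ := by
    rw [← LinearMap.range_eq_top, LinearMap.range_coprod, LinearMap.range_coprod,
      Submodule.range_subtype, Submodule.range_subtype, hD.sup_eq_top]
  have hf_inj : Function.Injective f := by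
    rw [injective_iff_map_eq_zero]
    rintro ⟨⟨u, c⟩, d⟩ hx
    have hB0 : B (e₀ ((u, c), d)) = 0 := by rw [← hBf, hx, map_zero]
    obtain rfl : d = 0 := hsep d (by
      have h1 := hCle hB0
      rw [he₀] at h1
      have h2 := sub_mem h1 (Submodule.add_mem_sup ⟨u, rfl⟩ c.2 : A u + c ∈ LinearMap.range A ⊔ C)
      rwa [add_sub_cancel_left] at h2)
    rw [hf, Submodule.coe_zero, map_zero, map_zero, add_zero] at hx
    obtain rfl : u = 0 := hCA' u (by
      rw [eq_neg_of_add_eq_zero_left hx]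
      exact neg_mem (φ c).2)
    rw [map_zero, zero_add] at hx
    obtain rfl : c = 0 := φ.injective ((Subtype.ext hx : φ c = 0).trans (map_zero φ).symm)
    rfl
  let e := LinearEquiv.ofBijective e₀ ⟨he_inj, he_surj⟩
  have hes : ∀ x, e.symm (e₀ x) = x := fun x => e.symm_apply_apply x
  refine ⟨f ∘ₗ e.symm.toLinearMap, hf_inj.comp e.symm.injective, ?_, ?_⟩
  · ext u
    have h1 : A u = e₀ ((u, 0), 0) := by simp [he₀]
    rw [LinearMap.comp_apply, LinearMap.comp_apply, LinearEquiv.coe_coe, h1, hes, hf]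
    simp
  · ext w
    rw [LinearMap.comp_apply, LinearMap.comp_apply, hBf]
    exact congrArg B (e.apply_symm_apply w)

theorem exists_matrix_conj {k l : ℕ} {A A' : Matrix (Fin l) (Fin k) ℂ}
    {B B' : Matrix (Fin k) (Fin l) ℂ} (hA : ∃ L : Matrix (Fin k) (Fin l) ℂ, L * A = 1)
    (hA' : ∃ L : Matrix (Fin k) (Fin l) ℂ, L * A' = 1)
    (hB : ∃ R : Matrix (Fin l) (Fin k) ℂ, B * R = 1)
    (hB' : ∃ R : Matrix (Fin l) (Fin k) ℂ, B' * R = 1)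
    (h : B * A = B' * A') :
    ∃ g g' : Matrix (Fin l) (Fin l) ℂ, g' * g = 1 ∧ g * A = A' ∧ B * g' = B' := by
  have inj : ∀ {A : Matrix (Fin l) (Fin k) ℂ}, (∃ L : Matrix (Fin k) (Fin l) ℂ, L * A = 1) →
      Function.Injective (Matrix.toLin' A) := by
    rintro A ⟨L, hL⟩
    refine Function.LeftInverse.injective (g := Matrix.toLin' L) fun v => ?_
    rw [← LinearMap.comp_apply, ← Matrix.toLin'_mul, hL, Matrix.toLin'_one, LinearMap.id_apply]
  have surj : ∀ {B : Matrix (Fin k) (Fin l) ℂ}, (∃ R : Matrix (Fin l) (Fin k) ℂ, B * R = 1) →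
      Function.Surjective (Matrix.toLin' B) := by
    rintro B ⟨R, hR⟩
    refine Function.RightInverse.surjective (g := Matrix.toLin' R) fun v => ?_
    rw [← LinearMap.comp_apply, ← Matrix.toLin'_mul, hR, Matrix.toLin'_one, LinearMap.id_apply]
  obtain ⟨g, hg, hgA, hgB⟩ := exists_linearMap_conj (inj hA) (inj hA') (surj hB) (surj hB')
    (by rw [← Matrix.toLin'_mul, ← Matrix.toLin'_mul, h])
  set G := LinearMap.toMatrix' g
  have hGg : Matrix.toLin' G = g := Matrix.toLin'_toMatrix' g
  have hG : IsUnit G := by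
    rw [← Matrix.mulVec_injective_iff_isUnit]
    intro v w hvw
    refine hg ?_
    rw [← hGg]
    exact hvw
  obtain ⟨u, hu⟩ := hG
  have hGA : G * A = A' := Matrix.toLin'.injective (by rw [Matrix.toLin'_mul, hGg, hgA])
  have hGB : B' * G = B := Matrix.toLin'.injective (by rw [Matrix.toLin'_mul, hGg, hgB])
  refine ⟨G, (u⁻¹ : (Matrix (Fin l) (Fin l) ℂ)ˣ), ?_, hGA, ?_⟩
  · rw [← hu, Units.inv_mul]
  · rw [← hGB, ← hu, Matrix.mul_assoc, Units.mul_inv, Matrix.mul_one]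

/-- All quiver data `(A_i, B_i)` with injective `A_i`, surjective `B_i` and
`B_{i+1} A_{i+1} = A_i B_i` are conjugate under `∏ GL(U_i)`. -/
theorem exists_quiver_conj {d : ℕ → ℕ} (hd : d 0 = 0) {t : ℕ}
    {A A' : ∀ i, i < t → Matrix (Fin (d (i + 1))) (Fin (d i)) ℂ}
    {B B' : ∀ i, i < t → Matrix (Fin (d i)) (Fin (d (i + 1))) ℂ}
    (hA : ∀ i hi, ∃ L : Matrix (Fin (d i)) (Fin (d (i + 1))) ℂ, L * A i hi = 1)
    (hA' : ∀ i hi, ∃ L : Matrix (Fin (d i)) (Fin (d (i + 1))) ℂ, L * A' i hi = 1)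
    (hB : ∀ i hi, ∃ R : Matrix (Fin (d (i + 1))) (Fin (d i)) ℂ, B i hi * R = 1)
    (hB' : ∀ i hi, ∃ R : Matrix (Fin (d (i + 1))) (Fin (d i)) ℂ, B' i hi * R = 1)
    (h : ∀ (i : ℕ) (hi : i + 1 < t), B (i + 1) hi * A (i + 1) hi =
      A i (by omega) * B i (by omega))
    (h' : ∀ (i : ℕ) (hi : i + 1 < t), B' (i + 1) hi * A' (i + 1) hi =
      A' i (by omega) * B' i (by omega)) :
    ∃ g g' : ∀ i, Matrix (Fin (d i)) (Fin (d i)) ℂ, (∀ i, g' i * g i = 1) ∧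
      (∀ i hi, g (i + 1) * A i hi * g' i = A' i hi) ∧
      ∀ i hi, g i * B i hi * g' (i + 1) = B' i hi := by
  suffices H : ∀ n ≤ t, ∃ g g' : ∀ i, Matrix (Fin (d i)) (Fin (d i)) ℂ, (∀ i, g' i * g i = 1) ∧
      (∀ i hi, i < n → g (i + 1) * A i hi * g' i = A' i hi) ∧
      ∀ i hi, i < n → g i * B i hi * g' (i + 1) = B' i hi by
    obtain ⟨g, g', h1, h2, h3⟩ := H t le_rfl
    exact ⟨g, g', h1, fun i hi => h2 i hi hi, fun i hi => h3 i hi hi⟩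
  intro n
  induction n with
  | zero => exact fun _ => ⟨1, 1, fun i => one_mul 1, fun i _ hi => absurd hi (Nat.not_lt_zero _),
      fun i _ hi => absurd hi (Nat.not_lt_zero _)⟩
  | succ n ih =>
    intro hn
    obtain ⟨g, g', hg, hgA, hgB⟩ := ih (by omega)
    have hgr : ∀ i, g i * g' i = 1 := fun i => mul_eq_one_comm.1 (hg i)
    have hcomp : g n * B n hn * (A n hn * g' n) = B' n hn * A' n hn := by
      rcases n with _ | n
      · have : IsEmpty (Fin (d 0)) := by rw [hd]; infer_instance
        exact Subsingleton.elim _ _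
      · rw [h', ← hgA n (by omega) (by omega), ← hgB n (by omega) (by omega), Matrix.mul_assoc,
          ← Matrix.mul_assoc (B _ _), h]
        simp only [Matrix.mul_assoc]
        rw [← Matrix.mul_assoc (g' n), hg, Matrix.one_mul]
    obtain ⟨G, G', hG, hGA, hGB⟩ := exists_matrix_conj (A := A n hn * g' n) (A' := A' n hn)
      (B := g n * B n hn) (B' := B' n hn)
      (by
        obtain ⟨L, hL⟩ := hA n hn
        exact ⟨g n * L, by rw [Matrix.mul_assoc, ← Matrix.mul_assoc L, hL, Matrix.one_mul, hgr]⟩)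
      (hA' n hn)
      (by
        obtain ⟨R, hR⟩ := hB n hn
        exact ⟨R * g' n, by rw [Matrix.mul_assoc, ← Matrix.mul_assoc _ R, hR, Matrix.one_mul, hgr]⟩)
      (hB' n hn) hcomp
    refine ⟨Function.update g (n + 1) G, Function.update g' (n + 1) G', fun i => ?_,
      fun i hi hin => ?_, fun i hi hin => ?_⟩
    · by_cases hi : i = n + 1
      · subst hi
        simpa using hG
      · rw [Function.update_of_ne hi, Function.update_of_ne hi, hg]
    · rw [Function.update_of_ne (a := i) (by omega)]
      by_cases h1 : i = n
      · subst h1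
        rw [Function.update_self, Matrix.mul_assoc, hGA]
      · rw [Function.update_of_ne (by omega), hgA i hi (by omega)]
    · rw [Function.update_of_ne (a := i) (by omega)]
      by_cases h1 : i = n
      · subst h1
        rw [Function.update_self, hGB]
      · rw [Function.update_of_ne (by omega), hgB i hi (by omega)]

end Transitivity

/-! ### Boxes and the index set `I` -/

section Boxes

variable (μ ν : YoungDiagram)

/-- The diagram of the nilpotent endomorphism of `U_i`: the boxes of `λ` whose `(t - i)`-th right
neighbour belongs to `λ`. -/
def levelBoxes (i : ℕ) : Finset (ℕ × ℕ) :=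
  (sumDiagram μ ν).cells.filter fun c => (c.1, c.2 + (numCols μ ν - i)) ∈ sumDiagram μ ν

variable {μ ν}

theorem mem_levelBoxes {i : ℕ} {c : ℕ × ℕ} :
    c ∈ levelBoxes μ ν i ↔ c.2 + (numCols μ ν - i) < (sumDiagram μ ν).rowLen c.1 := by
  rw [levelBoxes, Finset.mem_filter, YoungDiagram.mem_cells, ← YoungDiagram.mem_iff_lt_rowLen]
  exact and_iff_right_of_imp fun h =>
    YoungDiagram.up_left_mem _ le_rfl (Nat.le_add_right _ _) h

theorem card_levelBoxes {i : ℕ} (hi : i ≤ numCols μ ν) :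
    (levelBoxes μ ν i).card = dimU (colSeq μ ν) i := by
  have h1 : ∀ c ∈ levelBoxes μ ν i, c.2 ∈ Finset.range i := by
    intro c hc
    have h2 := mem_levelBoxes.1 hc
    have h3 : (sumDiagram μ ν).rowLen c.1 ≤ numCols μ ν :=
      (sumDiagram μ ν).rowLen_anti 0 c.1 (Nat.zero_le _)
    rw [Finset.mem_range]
    omega
  rw [Finset.card_eq_sum_card_fiberwise h1, dimU,
    ← Finset.sum_range_reflect (colSeq μ ν)]
  refine Finset.sum_congr rfl fun j hj => ?_
  rw [Finset.mem_range] at hj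
  rw [colSeq, YoungDiagram.colLen_eq_card, show numCols μ ν - 1 - (i - 1 - j) =
    j + (numCols μ ν - i) by omega]
  refine Finset.card_bij' (fun c _ => (c.1, j + (numCols μ ν - i))) (fun c _ => (c.1, j)) ?_ ?_ ?_ ?_
  · rintro ⟨a, k⟩ hc
    obtain ⟨h, rfl⟩ := Finset.mem_filter.1 hc
    rw [YoungDiagram.mem_col_iff]
    exact ⟨YoungDiagram.mem_iff_lt_rowLen.2 (mem_levelBoxes.1 h), rfl⟩
  · rintro ⟨a, k⟩ hc
    obtain ⟨h, rfl⟩ := YoungDiagram.mem_col_iff.1 hc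
    exact Finset.mem_filter.2 ⟨mem_levelBoxes.2 (YoungDiagram.mem_iff_lt_rowLen.1 h), rfl⟩
  · rintro ⟨a, k⟩ hc
    obtain ⟨h, rfl⟩ := Finset.mem_filter.1 hc
    rfl
  · rintro ⟨a, k⟩ hc
    obtain ⟨h, rfl⟩ := YoungDiagram.mem_col_iff.1 hc
    rfl

theorem card_eq_sum_rowLen (Y : YoungDiagram) {N : ℕ} (hN : Y.colLen 0 ≤ N) :
    Y.card = ∑ a ∈ Finset.range N, Y.rowLen a := by
  have h1 : ∀ c ∈ Y.cells, c.1 ∈ Finset.range N := fun c hc => by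
    have h2 : (c.1, 0) ∈ Y := Y.up_left_mem le_rfl (Nat.zero_le _) hc
    rw [YoungDiagram.mem_iff_lt_colLen] at h2
    exact Finset.mem_range.2 (h2.trans_le hN)
  rw [YoungDiagram.card, Finset.card_eq_sum_card_fiberwise h1]
  exact Finset.sum_congr rfl fun a _ => (Y.rowLen_eq_card).symm

theorem card_sumDiagram (μ ν : YoungDiagram) : (sumDiagram μ ν).card = μ.card + ν.card := by
  rw [card_eq_sum_rowLen _ (le_max_right (max (μ.colLen 0) (ν.colLen 0)) _),
    card_eq_sum_rowLen μ ((le_max_left _ _).trans (le_max_left _ _)),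
    card_eq_sum_rowLen ν ((le_max_right _ _).trans (le_max_left _ _)),
    ← Finset.sum_add_distrib]
  exact Finset.sum_congr rfl fun a _ => rowLen_sumDiagram μ ν a

theorem dimU_numCols (μ ν : YoungDiagram) :
    dimU (colSeq μ ν) (numCols μ ν) = μ.card + ν.card := by
  rw [← card_sumDiagram, ← card_levelBoxes le_rfl, YoungDiagram.card]
  congr 1
  ext c
  rw [mem_levelBoxes, Nat.sub_self, add_zero, YoungDiagram.mem_cells,
    ← YoungDiagram.mem_iff_lt_rowLen]

variable (μ ν)

/-- The number of elements of `I` that are at least `i`. -/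
def numGE (i : ℕ) : ℕ := ((Finset.Ico i (numCols μ ν)).filter (· ∈ colSet μ ν)).card

/-- The number of elements of the complement of `I` that are at least `i`. -/
def numGE' (i : ℕ) : ℕ := ((Finset.Ico i (numCols μ ν)).filter (· ∉ colSet μ ν)).card

variable {μ ν}

theorem numGE_add_numGE' (i : ℕ) : numGE μ ν i + numGE' μ ν i = numCols μ ν - i := by
  rw [numGE, numGE', Finset.card_filter_add_card_filter_not, Nat.card_Ico]

theorem numGE_anti : Antitone (numGE μ ν) := fun _ _ h =>
  Finset.card_le_card (Finset.filter_subset_filter _ (Finset.Ico_subset_Ico_left h))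

theorem numGE'_anti : Antitone (numGE' μ ν) := fun _ _ h =>
  Finset.card_le_card (Finset.filter_subset_filter _ (Finset.Ico_subset_Ico_left h))

theorem numGE_of_mem {i : ℕ} (hi : i < numCols μ ν) (hI : i ∈ colSet μ ν) :
    numGE μ ν i = numGE μ ν (i + 1) + 1 := by
  rw [numGE, ← Finset.insert_Ico_add_one_left_eq_Ico hi, Finset.filter_insert, if_pos hI,
    Finset.card_insert_of_notMem (by simp), numGE]

theorem numGE_of_notMem {i : ℕ} (hi : i < numCols μ ν) (hI : i ∉ colSet μ ν) :
    numGE μ ν i = numGE μ ν (i + 1) := by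
  rw [numGE, ← Finset.insert_Ico_add_one_left_eq_Ico hi, Finset.filter_insert, if_neg hI, numGE]

theorem numGE_numCols : numGE μ ν (numCols μ ν) = 0 := by simp [numGE]

theorem rowLen_le_numCols (a : ℕ) : (sumDiagram μ ν).rowLen a ≤ numCols μ ν :=
  (sumDiagram μ ν).rowLen_anti 0 a (Nat.zero_le _)

/-- Among the `λ_a` longest columns of `λ`, which are those that meet row `a`, there are `μ_a`
columns of `μ`. -/
theorem numGE_rowLen (a : ℕ) :
    numGE μ ν (numCols μ ν - (sumDiagram μ ν).rowLen a) = μ.rowLen a := by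
  have h := congrArg (fun s => (s.filter (a < ·)).card) (isColSet_colSet μ ν).lengths
  simp only [Multiset.filter_map, Multiset.card_map] at h
  have h1 : ((colSet μ ν).filter fun i => a < colSeq μ ν i).card = μ.rowLen a := by
    refine Eq.trans h ?_
    change ((Finset.range (μ.rowLen 0)).filter fun j => a < μ.colLen j).card = _
    rw [← Finset.card_range (μ.rowLen a)]
    congr 1
    ext j
    rw [Finset.mem_filter, Finset.mem_range, Finset.mem_range, ← YoungDiagram.mem_iff_lt_colLen,
      YoungDiagram.mem_iff_lt_rowLen]
    have := μ.rowLen_anti 0 a (Nat.zero_le _)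
    omega
  rw [← h1, numGE]
  congr 1
  ext i
  rw [Finset.mem_filter, Finset.mem_filter, Finset.mem_Ico, colSeq,
    ← YoungDiagram.mem_iff_lt_colLen, YoungDiagram.mem_iff_lt_rowLen]
  have h2 := rowLen_le_numCols (μ := μ) (ν := ν) a
  constructor
  · rintro ⟨h3, h4⟩
    exact ⟨h4, by omega⟩
  · rintro ⟨h3, h4⟩
    have := (isColSet_colSet μ ν).lt i h3
    exact ⟨by omega, h3⟩

theorem numGE'_rowLen (a : ℕ) :
    numGE' μ ν (numCols μ ν - (sumDiagram μ ν).rowLen a) = ν.rowLen a := by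
  have h1 := numGE_add_numGE' (μ := μ) (ν := ν) (numCols μ ν - (sumDiagram μ ν).rowLen a)
  have h2 := rowLen_le_numCols (μ := μ) (ν := ν) a
  have h3 := rowLen_sumDiagram μ ν a
  rw [numGE_rowLen] at h1
  omega

theorem numGE'_le_of_numGE_lt {i a : ℕ} (h : numGE μ ν i < μ.rowLen a) :
    numGE' μ ν i ≤ ν.rowLen a := by
  rw [← numGE'_rowLen (μ := μ) (ν := ν)]
  refine numGE'_anti ?_
  by_contra! hlt
  have := numGE_anti (μ := μ) (ν := ν) hlt.le
  rw [numGE_rowLen] at this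
  omega

/-- For `1 ≤ l ≤ ν_a` let `i` be the `l`-th element of the complement of `I`, counted from the top.
It belongs to one of the `λ_a` longest columns, so at most `μ_a` elements of `I` are larger. -/
theorem exists_index_of_box {a l : ℕ} (hl : 1 ≤ l) (hla : l ≤ ν.rowLen a) :
    ∃ i < numCols μ ν, i ∉ colSet μ ν ∧ numGE' μ ν i = l ∧ numGE μ ν i ≤ μ.rowLen a := by
  set s := numCols μ ν - (sumDiagram μ ν).rowLen a with hs
  let i := Nat.findGreatest (fun i => l ≤ numGE' μ ν i) (numCols μ ν)
  have hP : l ≤ numGE' μ ν s := by rwa [hs, numGE'_rowLen]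
  have hsi : s ≤ i := Nat.le_findGreatest (Nat.sub_le _ _) hP
  have hi : l ≤ numGE' μ ν i :=
    Nat.findGreatest_spec (P := fun i => l ≤ numGE' μ ν i) (Nat.sub_le _ _) hP
  have h0 : i < numCols μ ν := by
    refine lt_of_le_of_ne (Nat.findGreatest_le _) fun h => ?_
    have := numGE_add_numGE' (μ := μ) (ν := ν) i
    rw [h] at this hi
    omega
  have hi1 : ¬ l ≤ numGE' μ ν (i + 1) :=
    Nat.findGreatest_is_greatest (P := fun i => l ≤ numGE' μ ν i) (Nat.lt_succ_self i) h0
  have h1 := numGE_add_numGE' (μ := μ) (ν := ν) i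
  have h2 := numGE_add_numGE' (μ := μ) (ν := ν) (i + 1)
  have hI : i ∉ colSet μ ν := fun hI => by
    have := numGE_of_mem h0 hI
    omega
  have h3 := numGE_of_notMem h0 hI
  refine ⟨i, h0, hI, by omega, ?_⟩
  rw [← numGE_rowLen (μ := μ) (ν := ν) a]
  exact numGE_anti hsi

variable (μ ν)

/-- A numbering of the boxes in `levelBoxes μ ν i`. -/
def box (i : ℕ) (a : Fin (dimU (colSeq μ ν) i)) : ℕ × ℕ :=
  if h : i ≤ numCols μ ν then ((levelBoxes μ ν i).equivFinOfCardEq (card_levelBoxes h)).symm a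
  else (0, 0)

variable {μ ν}

theorem box_injective {i : ℕ} (hi : i ≤ numCols μ ν) : Function.Injective (box μ ν i) := by
  intro a b hab
  rw [box, box, dif_pos hi, dif_pos hi] at hab
  exact ((levelBoxes μ ν i).equivFinOfCardEq (card_levelBoxes hi)).symm.injective (Subtype.ext hab)

theorem exists_box_eq {i : ℕ} (hi : i ≤ numCols μ ν) {c : ℕ × ℕ} :
    (∃ a, box μ ν i a = c) ↔ c.2 + (numCols μ ν - i) < (sumDiagram μ ν).rowLen c.1 := by
  rw [← mem_levelBoxes]
  constructor
  · rintro ⟨a, rfl⟩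
    rw [box, dif_pos hi]
    exact (((levelBoxes μ ν i).equivFinOfCardEq (card_levelBoxes hi)).symm a).2
  · intro hc
    refine ⟨(levelBoxes μ ν i).equivFinOfCardEq (card_levelBoxes hi) ⟨c, hc⟩, ?_⟩
    rw [box, dif_pos hi, Equiv.symm_apply_apply]

theorem box_lt {i : ℕ} (hi : i ≤ numCols μ ν) (a : Fin (dimU (colSeq μ ν) i)) :
    (box μ ν i a).2 + (numCols μ ν - i) < (sumDiagram μ ν).rowLen (box μ ν i a).1 :=
  (exists_box_eq hi).1 ⟨a, rfl⟩

theorem sum_box_eq {i : ℕ} (hi : i ≤ numCols μ ν) {c : ℕ × ℕ} {a : Fin (dimU (colSeq μ ν) i)}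
    (ha : box μ ν i a = c) (f : Fin (dimU (colSeq μ ν) i) → ℂ) :
    ∑ b, (if box μ ν i b = c then f b else 0) = f a := by
  rw [Finset.sum_eq_single a, if_pos ha]
  · intro b _ hb
    exact if_neg fun h => hb (box_injective hi (h.trans ha.symm))
  · exact fun h => absurd (Finset.mem_univ a) h

theorem sum_box_eq_zero {i : ℕ} {c : ℕ × ℕ} (hc : ∀ b, box μ ν i b ≠ c)
    (f : Fin (dimU (colSeq μ ν) i) → ℂ) : ∑ b, (if box μ ν i b = c then f b else 0) = 0 :=
  Finset.sum_eq_zero fun b _ => if_neg (hc b)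

end Boxes

/-! ### The standard quiver data -/

section Standard

variable (μ ν : YoungDiagram)

/-- The inclusion of the boxes of `U_i` into those of `U_{i+1}`. -/
def stdA (i : ℕ) : Matrix (Fin (dimU (colSeq μ ν) (i + 1))) (Fin (dimU (colSeq μ ν) i)) ℂ :=
  Matrix.of fun a b => if box μ ν (i + 1) a = box μ ν i b then 1 else 0

/-- The map `U_{i+1} → U_i` that moves every box to its left neighbour. -/
def stdB (i : ℕ) : Matrix (Fin (dimU (colSeq μ ν) i)) (Fin (dimU (colSeq μ ν) (i + 1))) ℂ :=
  Matrix.of fun a b =>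
    if box μ ν (i + 1) b = ((box μ ν i a).1, (box μ ν i a).2 + 1) then 1 else 0

/-- The nilpotent endomorphism of `U_i` that moves every box to its left neighbour. -/
def stdN (i : ℕ) : Matrix (Fin (dimU (colSeq μ ν) i)) (Fin (dimU (colSeq μ ν) i)) ℂ :=
  Matrix.of fun a b => if box μ ν i b = ((box μ ν i a).1, (box μ ν i a).2 + 1) then 1 else 0

/-- The sum of the boxes of `U_i` that lie `numGE μ ν i` places to the left of the boxes at the
wall. -/
def stdU (i : ℕ) : Fin (dimU (colSeq μ ν) i) → ℂ :=
  fun a => if (box μ ν i a).2 + 1 + numGE μ ν i = μ.rowLen (box μ ν i a).1 then 1 else 0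

/-- The point of the quiver variety that is built from boxes; it lies over a point of the orbit. -/
def stdPoint (t : ℕ) : QuiverCoord (dimU (colSeq μ ν)) t → ℂ
  | .u i _ a => stdU μ ν i a
  | .A i _ a b => stdA μ ν i a b
  | .B i _ a b => stdB μ ν i a b

variable {μ ν}

theorem stdA_mulVec {i : ℕ} (hi : i < numCols μ ν) {a : Fin (dimU (colSeq μ ν) (i + 1))}
    {b : Fin (dimU (colSeq μ ν) i)} (h : box μ ν i b = box μ ν (i + 1) a)
    (w : Fin (dimU (colSeq μ ν) i) → ℂ) : (stdA μ ν i).mulVec w a = w b := by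
  rw [← sum_box_eq hi.le h w, Matrix.mulVec, dotProduct]
  refine Finset.sum_congr rfl fun c _ => ?_
  simp only [stdA, Matrix.of_apply, ite_mul, one_mul, zero_mul]
  simp only [eq_comm]

theorem stdA_mulVec_eq_zero {i : ℕ} {a : Fin (dimU (colSeq μ ν) (i + 1))}
    (h : ∀ b, box μ ν i b ≠ box μ ν (i + 1) a)
    (w : Fin (dimU (colSeq μ ν) i) → ℂ) : (stdA μ ν i).mulVec w a = 0 := by
  rw [← sum_box_eq_zero h w, Matrix.mulVec, dotProduct]
  refine Finset.sum_congr rfl fun c _ => ?_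
  simp only [stdA, Matrix.of_apply, ite_mul, one_mul, zero_mul]
  simp only [eq_comm]

theorem stdB_mulVec {i : ℕ} (hi : i < numCols μ ν) {a : Fin (dimU (colSeq μ ν) i)}
    {b : Fin (dimU (colSeq μ ν) (i + 1))}
    (h : box μ ν (i + 1) b = ((box μ ν i a).1, (box μ ν i a).2 + 1))
    (w : Fin (dimU (colSeq μ ν) (i + 1)) → ℂ) : (stdB μ ν i).mulVec w a = w b := by
  rw [← sum_box_eq hi h w, Matrix.mulVec, dotProduct]
  refine Finset.sum_congr rfl fun c _ => ?_
  simp only [stdB, Matrix.of_apply, ite_mul, one_mul, zero_mul]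

theorem exists_box_right {i : ℕ} (hi : i < numCols μ ν) (a : Fin (dimU (colSeq μ ν) i)) :
    ∃ b, box μ ν (i + 1) b = ((box μ ν i a).1, (box μ ν i a).2 + 1) := by
  rw [exists_box_eq hi]
  have := box_lt hi.le a
  dsimp only
  omega

theorem exists_box_same {i : ℕ} (hi : i < numCols μ ν) (a : Fin (dimU (colSeq μ ν) i)) :
    ∃ b, box μ ν (i + 1) b = box μ ν i a := by
  rw [exists_box_eq hi]
  have := box_lt hi.le a
  omega

theorem stdA_mul_stdB {i : ℕ} (hi : i < numCols μ ν) : stdA μ ν i * stdB μ ν i = stdN μ ν (i + 1) := by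
  ext a c
  change (stdA μ ν i).mulVec (fun b => stdB μ ν i b c) a = _
  by_cases h : ∃ b, box μ ν i b = box μ ν (i + 1) a
  · obtain ⟨b, hb⟩ := h
    rw [stdA_mulVec hi hb]
    simp only [stdB, stdN, Matrix.of_apply, hb]
  · rw [stdA_mulVec_eq_zero (not_exists.1 h), stdN, Matrix.of_apply, if_neg]
    intro hc
    refine h ((exists_box_eq hi.le).2 ?_)
    have := box_lt hi c
    rw [hc] at this
    dsimp only at this
    omega

theorem stdB_mul_stdA {i : ℕ} (hi : i < numCols μ ν) : stdB μ ν i * stdA μ ν i = stdN μ ν i := by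
  ext a c
  change (stdB μ ν i).mulVec (fun b => stdA μ ν i b c) a = _
  obtain ⟨b, hb⟩ := exists_box_right hi a
  rw [stdB_mulVec hi hb]
  simp only [stdA, stdN, Matrix.of_apply, hb]
  simp only [eq_comm]

theorem transpose_mul_stdA {i : ℕ} (hi : i < numCols μ ν) :
    (stdA μ ν i).transpose * stdA μ ν i = 1 := by
  ext a c
  obtain ⟨b, hb⟩ := exists_box_same hi a
  rw [Matrix.one_apply, Matrix.mul_apply]
  have := sum_box_eq hi hb fun b => stdA μ ν i b c
  simp only [stdA, Matrix.of_apply, Matrix.transpose_apply, ite_mul, one_mul, zero_mul, hb] at this ⊢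
  rw [this]
  simp only [(box_injective hi.le).eq_iff]

theorem stdB_mul_transpose {i : ℕ} (hi : i < numCols μ ν) :
    stdB μ ν i * (stdB μ ν i).transpose = 1 := by
  ext a c
  obtain ⟨b, hb⟩ := exists_box_right hi a
  rw [Matrix.one_apply]
  change (stdB μ ν i).mulVec (fun b => stdB μ ν i c b) a = _
  rw [stdB_mulVec hi hb, stdB, Matrix.of_apply, hb]
  have : ((box μ ν i a).1, (box μ ν i a).2 + 1) = ((box μ ν i c).1, (box μ ν i c).2 + 1) ↔ a = c := by
    rw [← (box_injective hi.le).eq_iff, Prod.ext_iff, Prod.ext_iff]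
    simp
  simp only [this]

theorem stdPoint_mem {t : ℕ} (ht : numCols μ ν = t) :
    stdPoint μ ν t ∈ quiverVariety (colSeq μ ν) t (colSet μ ν) := by
  subst ht
  refine ⟨fun i hi => ?_, fun i hi hI => ?_, fun i hi hI => ?_⟩
  · exact (stdB_mul_stdA hi).trans (stdA_mul_stdB (by omega)).symm
  · change (stdB μ ν i).mulVec (stdU μ ν (i + 1)) = stdU μ ν i
    ext a
    obtain ⟨b, hb⟩ := exists_box_right hi a
    rw [stdB_mulVec hi hb, stdU, stdU, hb, numGE_of_mem hi hI]
    simp only [add_comm, add_left_comm]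
  · change (stdA μ ν i).mulVec (stdU μ ν i) = stdU μ ν (i + 1)
    ext a
    by_cases h : ∃ b, box μ ν i b = box μ ν (i + 1) a
    · obtain ⟨b, hb⟩ := h
      rw [stdA_mulVec hi hb, stdU, stdU, hb, numGE_of_notMem hi hI]
    · rw [stdA_mulVec_eq_zero (not_exists.1 h), stdU, if_neg]
      intro ha
      refine h ((exists_box_eq hi.le).2 ?_)
      rw [← numGE_of_notMem hi hI] at ha
      have h1 := numGE'_le_of_numGE_lt (μ := μ) (ν := ν) (i := i) (a := (box μ ν (i + 1) a).1)
        (by omega)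
      have h2 := numGE_add_numGE' (μ := μ) (ν := ν) i
      rw [rowLen_sumDiagram]
      omega

/-- If the maps `A_i`, `B_i` of a point of the quiver variety are the standard ones, then `u_t` is
supported on the boxes to the left of the wall. -/
theorem uOf_support {t : ℕ} (ht : numCols μ ν = t) {p : QuiverCoord (dimU (colSeq μ ν)) t → ℂ}
    (hp : p ∈ quiverVariety (colSeq μ ν) t (colSet μ ν)) (hA : ∀ i hi, AOf p i hi = stdA μ ν i)
    (hB : ∀ i hi, BOf p i hi = stdB μ ν i) (a : Fin (dimU (colSeq μ ν) t))
    (ha : uOf p t le_rfl a ≠ 0) : (box μ ν t a).2 < μ.rowLen (box μ ν t a).1 := by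
  subst ht
  have key : ∀ k i (hi : i ≤ numCols μ ν), numCols μ ν - i = k →
      ∀ (c : Fin (dimU (colSeq μ ν) i)) (b : Fin (dimU (colSeq μ ν) (numCols μ ν))),
      box μ ν _ b = ((box μ ν i c).1, (box μ ν i c).2 + numGE μ ν i) →
      uOf p i hi c = uOf p _ le_rfl b := by
    intro k
    induction k with
    | zero =>
      intro i hi hk c b hb
      obtain rfl : i = numCols μ ν := by omega
      rw [numGE_numCols] at hb
      rw [box_injective le_rfl hb]
    | succ k ih =>
      intro i hi hk c b hb
      have hi' : i < numCols μ ν := by omega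
      by_cases hI : i ∈ colSet μ ν
      · obtain ⟨c', hc'⟩ := exists_box_right hi' c
        rw [← hp.2.1 i hi' hI, hB, stdB_mulVec hi' hc']
        refine ih (i + 1) hi' (by omega) c' b ?_
        rw [hb, hc', numGE_of_mem hi' hI]
        ext
        · rfl
        · dsimp only
          omega
      · obtain ⟨c', hc'⟩ := exists_box_same hi' c
        rw [← stdA_mulVec hi' hc'.symm (uOf p i hi), ← hA i hi', hp.2.2 i hi' hI]
        refine ih (i + 1) hi' (by omega) c' b ?_
        rw [hb, hc', numGE_of_notMem hi' hI]
  by_contra! hle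
  refine ha ?_
  have hlt := box_lt le_rfl a
  have hrow := rowLen_sumDiagram μ ν (box μ ν _ a).1
  obtain ⟨i, hi, hI, hil, hiμ⟩ := exists_index_of_box (μ := μ) (ν := ν)
    (a := (box μ ν _ a).1) (l := (sumDiagram μ ν).rowLen (box μ ν _ a).1 - (box μ ν _ a).2)
    (by omega) (by omega)
  have h1 := numGE_add_numGE' (μ := μ) (ν := ν) i
  obtain ⟨c, hc⟩ := (exists_box_eq (μ := μ) (ν := ν) (i := i + 1) hi
    (c := ((box μ ν _ a).1, (box μ ν _ a).2 - numGE μ ν i))).2 (by dsimp only; omega)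
  rw [← key _ (i + 1) hi rfl c a (by
    rw [hc, ← numGE_of_notMem hi hI]
    ext
    · rfl
    · dsimp only
      omega), ← hp.2.2 i hi hI, hA, stdA_mulVec_eq_zero]
  intro b hb
  have h2 := box_lt hi.le b
  rw [hb, hc] at h2
  dsimp only at h2
  omega

/-- A vector supported to the left of the wall, with nonzero coefficients at the wall, is the image
of the sum of the boxes at the wall under an automorphism that commutes with the standard
nilpotent endomorphism. On each row the automorphism is a polynomial in this endomorphism with
nonzero constant term. -/
theorem exists_commute_mulVec {t : ℕ} (ht : numCols μ ν = t) (v : Fin (dimU (colSeq μ ν) t) → ℂ)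
    (hv : ∀ a, v a ≠ 0 → (box μ ν t a).2 < μ.rowLen (box μ ν t a).1)
    (hgen : ∀ a, (box μ ν t a).2 + 1 = μ.rowLen (box μ ν t a).1 → v a ≠ 0) :
    ∃ T T' : Matrix (Fin (dimU (colSeq μ ν) t)) (Fin (dimU (colSeq μ ν) t)) ℂ, T' * T = 1 ∧
      T * stdN μ ν t = stdN μ ν t * T ∧ T.mulVec (stdU μ ν t) = v := by
  have hle : t ≤ numCols μ ν := ht.ge
  have hsub : numCols μ ν - t = 0 := by omega
  have hnum : numGE μ ν t = 0 := ht ▸ numGE_numCols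
  let vb : ℕ × ℕ → ℂ := fun c => ∑ b, if box μ ν t b = c then v b else 0
  have hvb : ∀ a, vb (box μ ν t a) = v a := fun a => sum_box_eq hle rfl v
  let γ : ℕ → ℕ → ℂ := fun ρ h => if μ.rowLen ρ = 0 then (if h = 0 then 1 else 0) else
    if h < μ.rowLen ρ then vb (ρ, μ.rowLen ρ - 1 - h) else 0
  let τ : ℕ × ℕ → ℕ × ℕ → ℂ := fun c c' =>
    if c.1 = c'.1 ∧ c.2 ≤ c'.2 then γ c.1 (c'.2 - c.2) else 0
  let T : Matrix (Fin (dimU (colSeq μ ν) t)) (Fin (dimU (colSeq μ ν) t)) ℂ :=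
    Matrix.of fun a b => τ (box μ ν t a) (box μ ν t b)
  have hmem : ∀ c : ℕ × ℕ, (∃ a, box μ ν t a = c) ↔ c.2 < (sumDiagram μ ν).rowLen c.1 := fun c => by
    rw [exists_box_eq hle, hsub, add_zero]
  have hγ : ∀ a, γ (box μ ν t a).1 0 ≠ 0 := by
    intro a
    simp only [γ]
    split_ifs with h0 h1
    · exact one_ne_zero
    · obtain ⟨b, hb⟩ := (hmem ((box μ ν t a).1, μ.rowLen (box μ ν t a).1 - 1)).2 (by
        rw [rowLen_sumDiagram]
        dsimp only
        omega)
      rw [Nat.sub_zero, ← hb, hvb]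
      refine hgen b ?_
      rw [hb]
      dsimp only
      omega
    · omega
  have hunit : IsUnit T := by
    rw [← Matrix.mulVec_injective_iff_isUnit]
    change Function.Injective T.mulVecLin
    rw [injective_iff_map_eq_zero]
    intro w hw
    by_contra hw0
    obtain ⟨a₀, ha₀⟩ := Function.ne_iff.1 hw0
    obtain ⟨a, ha, hmax⟩ := (Finset.univ.filter fun a => w a ≠ 0).exists_max_image
      (fun a => (box μ ν t a).2) ⟨a₀, by simpa using ha₀⟩
    have ha : w a ≠ 0 := (Finset.mem_filter.1 ha).2
    have h1 : T.mulVec w a = γ (box μ ν t a).1 0 * w a := by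
      rw [Matrix.mulVec, dotProduct, Finset.sum_eq_single a]
      · simp [T, τ]
      · intro b _ hb
        by_cases hwb : w b = 0
        · rw [hwb, mul_zero]
        · have h2 := hmax b (by simpa using hwb)
          simp only [T, Matrix.of_apply, τ]
          rw [if_neg, zero_mul]
          rintro ⟨h3, h4⟩
          exact hb (box_injective hle (Prod.ext h3.symm (le_antisymm h2 h4)))
      · exact fun h => absurd (Finset.mem_univ a) h
    exact mul_ne_zero (hγ a) ha (h1.symm.trans (congrFun hw a))
  have hcomm : T * stdN μ ν t = stdN μ ν t * T := by
    ext a c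
    have hL : (T * stdN μ ν t) a c = if (box μ ν t c).2 = 0 then 0 else
        τ (box μ ν t a) ((box μ ν t c).1, (box μ ν t c).2 - 1) := by
      rw [Matrix.mul_apply]
      split_ifs with h0
      · refine Finset.sum_eq_zero fun b _ => ?_
        rw [stdN, Matrix.of_apply, if_neg, mul_zero]
        intro h
        rw [h] at h0
        simp at h0
      · obtain ⟨b, hb⟩ := (hmem ((box μ ν t c).1, (box μ ν t c).2 - 1)).2 (by
          have := (hmem _).1 ⟨c, rfl⟩
          dsimp only
          omega)
        rw [← hb]
        rw [← sum_box_eq hle hb fun b => τ (box μ ν t a) (box μ ν t b)]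
        refine Finset.sum_congr rfl fun d _ => ?_
        simp only [T, stdN, Matrix.of_apply, mul_ite, mul_one, mul_zero]
        refine if_congr ?_ rfl rfl
        rw [Prod.ext_iff, Prod.ext_iff]
        dsimp only
        omega
    have hR : (stdN μ ν t * T) a c =
        if (box μ ν t a).2 + 1 < (sumDiagram μ ν).rowLen (box μ ν t a).1 then
          τ ((box μ ν t a).1, (box μ ν t a).2 + 1) (box μ ν t c) else 0 := by
      rw [Matrix.mul_apply]
      simp only [stdN, Matrix.of_apply, ite_mul, one_mul, zero_mul]
      split_ifs with h
      · obtain ⟨b, hb⟩ := (hmem ((box μ ν t a).1, (box μ ν t a).2 + 1)).2 h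
        rw [sum_box_eq hle hb, ← hb]
        rfl
      · exact sum_box_eq_zero (fun b hb => h ((hmem _).1 ⟨b, hb⟩)) _
    rw [hL, hR]
    have hc := (hmem _).1 ⟨c, rfl⟩
    simp only [τ]
    by_cases h1 : (box μ ν t a).1 = (box μ ν t c).1
    · rw [h1]
      by_cases h2 : (box μ ν t a).2 + 1 ≤ (box μ ν t c).2
      · rw [if_neg (by omega), if_pos ⟨rfl, by omega⟩, if_pos (by omega),
          if_pos ⟨rfl, h2⟩]
        congr 1
        omega
      · have h3 : ¬ (box μ ν t a).2 + 1 ≤ (box μ ν t c).2 := h2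
        simp only [h3, and_false, if_false, ite_self]
        split_ifs with h4 h5
        · rfl
        · omega
        · rfl
    · simp [h1]
  have hvec : T.mulVec (stdU μ ν t) = v := by
    ext a
    rw [Matrix.mulVec, dotProduct]
    simp only [stdU, hnum, add_zero, mul_ite, mul_one, mul_zero]
    by_cases h0 : μ.rowLen (box μ ν t a).1 = 0
    · rw [Finset.sum_eq_zero]
      · by_contra h
        have := hv a (Ne.symm h)
        omega
      · intro b _
        split_ifs with h1
        · simp only [T, τ, Matrix.of_apply]
          rw [if_neg]
          rintro ⟨h2, _⟩
          rw [← h2, h0] at h1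
          omega
        · rfl
    · obtain ⟨b, hb⟩ := (hmem ((box μ ν t a).1, μ.rowLen (box μ ν t a).1 - 1)).2 (by
        rw [rowLen_sumDiagram]
        dsimp only
        omega)
      rw [Finset.sum_eq_single b]
      · rw [if_pos (by
          rw [hb]
          dsimp only
          omega)]
        simp only [T, τ, γ, Matrix.of_apply, hb, h0, if_false, true_and]
        by_cases h1 : (box μ ν t a).2 < μ.rowLen (box μ ν t a).1
        · rw [if_pos (by omega), if_pos (by omega), ← hvb]
          congr 1
          ext
          · rfl
          · dsimp only
            omega
        · rw [if_neg (by omega)]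
          by_contra h
          exact h1 (hv a (Ne.symm h))
      · intro c _ hc
        split_ifs with h1
        · simp only [T, τ, Matrix.of_apply]
          rw [if_neg]
          rintro ⟨h2, h3⟩
          refine hc (box_injective hle ?_)
          rw [hb, h2]
          ext
          · rfl
          · dsimp only
            omega
        · rfl
      · exact fun h => absurd (Finset.mem_univ b) h
  obtain ⟨u, hu⟩ := hunit
  refine ⟨T, (u⁻¹ : (Matrix _ _ ℂ)ˣ), ?_, hcomm, hvec⟩
  rw [← hu, Units.inv_mul]

end Standard

/-! ### The orbit and the image of the projection -/

section Orbit

variable {μ ν : YoungDiagram}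

theorem exists_equiv_cells {t : ℕ} (ht : numCols μ ν = t) :
    ∃ e : Fin (dimU (colSeq μ ν) t) ≃ (sumDiagram μ ν).cells, ∀ a, (e a : ℕ × ℕ) = box μ ν t a := by
  subst ht
  have hmem : ∀ c, (∃ a, box μ ν (numCols μ ν) a = c) ↔ c ∈ (sumDiagram μ ν).cells := fun c => by
    rw [exists_box_eq le_rfl, Nat.sub_self, add_zero, YoungDiagram.mem_cells,
      ← YoungDiagram.mem_iff_lt_rowLen]
  refine ⟨Equiv.ofBijective (fun a => ⟨box μ ν _ a, (hmem _).1 ⟨a, rfl⟩⟩) ⟨fun a b hab => ?_, ?_⟩,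
    fun a => rfl⟩
  · exact box_injective le_rfl (congrArg Subtype.val hab)
  · rintro ⟨c, hc⟩
    obtain ⟨a, ha⟩ := (hmem c).2 hc
    exact ⟨a, Subtype.ext ha⟩

/-- The orbit in terms of matrices: it consists of the conjugates of the pair `(stdU, stdN)`. -/
theorem mem_orbit_iff {t : ℕ} (ht : numCols μ ν = t)
    {q : PairCoord (dimU (colSeq μ ν) t) → ℂ} :
    q ∈ orbit μ ν (dimU (colSeq μ ν) t) ↔
      ∃ M M' : Matrix (Fin (dimU (colSeq μ ν) t)) (Fin (dimU (colSeq μ ν) t)) ℂ, M' * M = 1 ∧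
        endOf q * M = M * stdN μ ν t ∧ vecOf q = M.mulVec (stdU μ ν t) := by
  obtain ⟨e, he⟩ := exists_equiv_cells ht
  have hle : t ≤ numCols μ ν := ht.ge
  have hnum : numGE μ ν t = 0 := ht ▸ numGE_numCols
  -- For a matrix with columns `f a` the conditions of the orbit say that it conjugates `stdN`.
  have hN : ∀ M : Matrix (Fin (dimU (colSeq μ ν) t)) (Fin (dimU (colSeq μ ν) t)) ℂ, ∀ i c,
      (∀ b, box μ ν t c = ((box μ ν t b).1, (box μ ν t b).2 + 1) →
        (M * stdN μ ν t) i c = M i b) ∧ ((box μ ν t c).2 = 0 → (M * stdN μ ν t) i c = 0) := by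
    intro M i c
    rw [Matrix.mul_apply]
    simp only [stdN, Matrix.of_apply, mul_ite, mul_one, mul_zero]
    refine ⟨fun b hb => ?_, fun h0 => Finset.sum_eq_zero fun b _ => if_neg fun h => ?_⟩
    · rw [← sum_box_eq hle rfl fun b => M i b]
      refine Finset.sum_congr rfl fun d _ => if_congr ?_ rfl rfl
      rw [hb, Prod.ext_iff, Prod.ext_iff]
      dsimp only
      omega
    · rw [h] at h0
      exact absurd h0 (Nat.succ_ne_zero _)
  have hU : ∀ M : Matrix (Fin (dimU (colSeq μ ν) t)) (Fin (dimU (colSeq μ ν) t)) ℂ,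
      M.mulVec (stdU μ ν t) = ∑ c : (sumDiagram μ ν).cells with c.1.2 + 1 = μ.rowLen c.1.1,
        fun i => M i (e.symm c) := by
    intro M
    ext i
    rw [Finset.sum_apply, Finset.sum_filter, Matrix.mulVec, dotProduct]
    refine Fintype.sum_equiv e _ _ fun a => ?_
    simp only [stdU, hnum, add_zero, he, Equiv.symm_apply_apply, mul_ite, mul_one, mul_zero]
  constructor
  · rintro ⟨b, hb1, hb2, hb3⟩
    let c := b.reindex e.symm
    refine ⟨(Pi.basisFun ℂ _).toMatrix c, c.toMatrix (Pi.basisFun ℂ _),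
      c.toMatrix_mul_toMatrix_flip _, ?_, ?_⟩
    · have hcol : ∀ i a, ((Pi.basisFun ℂ _).toMatrix c) i a = b (e a) i := fun i a => by
        simp [c, Module.Basis.toMatrix_apply]
      ext i a
      have hlhs : (endOf q * (Pi.basisFun ℂ _).toMatrix c) i a = (endOf q).mulVec (b (e a)) i := by
        rw [Matrix.mul_apply, Matrix.mulVec, dotProduct]
        exact Finset.sum_congr rfl fun k _ => by rw [hcol]
      rw [hlhs]
      by_cases h0 : (box μ ν t a).2 = 0
      · rw [hb2 (e a) (by rw [he, h0]), (hN _ i a).2 h0]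
        rfl
      · obtain ⟨d, hd⟩ := (exists_box_eq (i := t) hle
          (c := ((box μ ν t a).1, (box μ ν t a).2 - 1))).2 (by
            have := box_lt hle a
            dsimp only
            omega)
        have hd1 : (box μ ν t d).1 = (box μ ν t a).1 := by rw [hd]
        have hd2 : (box μ ν t a).2 = (box μ ν t d).2 + 1 := by
          rw [hd]
          dsimp only
          omega
        rw [hb1 (e a) (e d) (by rw [he, he, hd1]) (by rw [he, he, hd2]),
          (hN _ i a).1 d (Prod.ext hd1.symm hd2), hcol]
    · rw [hb3, hU]
      refine Finset.sum_congr rfl fun k _ => ?_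
      ext i
      simp [c, Module.Basis.toMatrix_apply]
  · rintro ⟨M, M', hM, hq, hv⟩
    let b := ((Pi.basisFun ℂ _).map
      (Matrix.toLin'OfInv hM (mul_eq_one_comm.1 hM))).reindex e
    have hb : ∀ a i, b (e a) i = M i a := fun a i => by
      simp [b, Matrix.toLin'OfInv]
    have hmul : ∀ a i, (endOf q).mulVec (b (e a)) i = (M * stdN μ ν t) i a := fun a i => by
      rw [← hq, Matrix.mul_apply, Matrix.mulVec, dotProduct]
      exact Finset.sum_congr rfl fun k _ => by rw [hb]
    refine ⟨b, fun c c' h1 h2 => ?_, fun c h0 => ?_, ?_⟩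
    · obtain ⟨a, rfl⟩ := e.surjective c
      obtain ⟨a', rfl⟩ := e.surjective c'
      ext i
      rw [he, he] at h1 h2
      rw [hmul, hb, (hN M i a).1 a' (Prod.ext h1 h2)]
    · obtain ⟨a, rfl⟩ := e.surjective c
      ext i
      rw [he] at h0
      rw [hmul, (hN M i a).2 h0]
      rfl
    · rw [hv, hU]
      refine Finset.sum_congr rfl fun c _ => ?_
      obtain ⟨a, rfl⟩ := e.surjective c
      ext i
      rw [hb, Equiv.symm_apply_apply]

variable {s : ℕ}

/-- Every point of the orbit is the projection of a point of the quiver variety. -/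
theorem exists_projPoint_eq (hs : numCols μ ν = s + 1)
    {q : PairCoord (dimU (colSeq μ ν) (s + 1)) → ℂ}
    (hq : q ∈ orbit μ ν (dimU (colSeq μ ν) (s + 1))) :
    ∃ p ∈ quiverVariety (colSeq μ ν) (s + 1) (colSet μ ν), projPoint p = q := by
  obtain ⟨M, M', hM, hqM, hv⟩ := (mem_orbit_iff hs).1 hq
  have hM' : M * M' = 1 := mul_eq_one_comm.1 hM
  refine ⟨actPoint (Function.update 1 (s + 1) M) (Function.update 1 (s + 1) M')
    (stdPoint μ ν (s + 1)), actPoint_mem (fun i => ?_) (stdPoint_mem hs), ?_⟩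
  · by_cases hi : i = s + 1
    · subst hi
      simpa using hM
    · rw [Function.update_of_ne hi, Function.update_of_ne hi]
      exact one_mul 1
  · have hA : AOf (stdPoint μ ν (s + 1)) s s.lt_succ_self = stdA μ ν s := rfl
    have hB : BOf (stdPoint μ ν (s + 1)) s s.lt_succ_self = stdB μ ν s := rfl
    have hvec : vecOf (projPoint (actPoint (Function.update 1 (s + 1) M)
        (Function.update 1 (s + 1) M') (stdPoint μ ν (s + 1)))) = vecOf q := by
      rw [vecOf_projPoint, uOf_actPoint, Function.update_self, hv]
      rfl
    have hend : endOf (projPoint (actPoint (Function.update 1 (s + 1) M)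
        (Function.update 1 (s + 1) M') (stdPoint μ ν (s + 1)))) = endOf q := by
      have h1 : Function.update (1 : ∀ i, Matrix (Fin (dimU (colSeq μ ν) i))
        (Fin (dimU (colSeq μ ν) i)) ℂ) (s + 1) M s = 1 := Function.update_of_ne (by omega) _ _
      have h1' : Function.update (1 : ∀ i, Matrix (Fin (dimU (colSeq μ ν) i))
        (Fin (dimU (colSeq μ ν) i)) ℂ) (s + 1) M' s = 1 := Function.update_of_ne (by omega) _ _
      rw [endOf_projPoint, AOf_actPoint, BOf_actPoint, Function.update_self, Function.update_self,
        h1, h1', Matrix.mul_one, Matrix.one_mul, hA, hB, Matrix.mul_assoc, ← Matrix.mul_assoc _ _ M',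
        stdA_mul_stdB (by omega), ← Matrix.mul_assoc, ← hqM, Matrix.mul_assoc, hM', Matrix.mul_one]
    funext c
    rcases c with a | ⟨a, b⟩
    · exact congrFun hvec a
    · exact congrFun (congrFun hend a) b

/-- A polynomial that vanishes on the orbit vanishes on the projections of all points of the quiver
variety with injective `A_i` and surjective `B_i`. Up to the action of `∏ GL(U_i)` the maps are
the standard ones; then `u_t` lies in a subspace in which the vectors that give points
of the orbit are dense. -/
theorem aeval_projPoint_eq_zero (hs : numCols μ ν = s + 1)
    {F : MvPolynomial (PairCoord (dimU (colSeq μ ν) (s + 1))) ℂ}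
    (hF : F ∈ vanishingIdeal ℂ (orbit μ ν (dimU (colSeq μ ν) (s + 1))))
    {p : QuiverCoord (dimU (colSeq μ ν)) (s + 1) → ℂ}
    (hp : p ∈ quiverVariety (colSeq μ ν) (s + 1) (colSet μ ν))
    (hA : ∀ i hi, ∃ L : Matrix (Fin (dimU (colSeq μ ν) i)) (Fin (dimU (colSeq μ ν) (i + 1))) ℂ,
      L * AOf p i hi = 1)
    (hB : ∀ i hi, ∃ R : Matrix (Fin (dimU (colSeq μ ν) (i + 1))) (Fin (dimU (colSeq μ ν) i)) ℂ,
      BOf p i hi * R = 1) : aeval (projPoint p) F = 0 := by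
  obtain ⟨g, g', hg, hgA, hgB⟩ := exists_quiver_conj (d := dimU (colSeq μ ν)) rfl
    (A := AOf p) (A' := fun i _ => stdA μ ν i) (B := BOf p) (B' := fun i _ => stdB μ ν i) hA
    (fun i hi => ⟨_, transpose_mul_stdA (hs ▸ hi)⟩) hB
    (fun i hi => ⟨_, stdB_mul_transpose (hs ▸ hi)⟩) hp.1
    fun i hi => (stdB_mul_stdA (hs ▸ hi)).trans (stdA_mul_stdB (by omega)).symm
  have hg' : ∀ i, g i * g' i = 1 := fun i => mul_eq_one_comm.1 (hg i)
  have hsupp := uOf_support hs (actPoint_mem hg hp) (fun i hi => hgA i hi) (fun i hi => hgB i hi)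
  rw [uOf_actPoint] at hsupp
  set v := (g (s + 1)).mulVec (uOf p (s + 1) le_rfl) with hv
  let q : ℂ → PairCoord (dimU (colSeq μ ν) (s + 1)) → ℂ := fun z c => match c with
    | .v a => (g' (s + 1)).mulVec (v + z • stdU μ ν (s + 1)) a
    | .x a b => projPoint p (.x a b)
  have hq0 : q 0 = projPoint p := by
    funext c
    rcases c with a | ⟨a, b⟩
    · simp only [q]
      rw [zero_smul, add_zero, hv, Matrix.mulVec_mulVec, hg, Matrix.one_mulVec]
      rfl
    · rfl
  have hend : endOf (projPoint p) * g' (s + 1) = g' (s + 1) * stdN μ ν (s + 1) := by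
    rw [endOf_projPoint, ← stdA_mul_stdB (by omega), ← hgA s s.lt_succ_self,
      ← hgB s s.lt_succ_self]
    simp only [Matrix.mul_assoc]
    rw [← Matrix.mul_assoc (g' (s + 1)), hg, Matrix.one_mul, ← Matrix.mul_assoc (g' s), hg,
      Matrix.one_mul]
  have hnum : numGE μ ν (s + 1) = 0 := by
    rw [← hs]
    exact numGE_numCols
  have hgen : ∀ᶠ z : ℂ in nhdsWithin 0 {0}ᶜ, ∀ a,
      (box μ ν (s + 1) a).2 + 1 = μ.rowLen (box μ ν (s + 1) a).1 →
        (v + z • stdU μ ν (s + 1)) a ≠ 0 := by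
    rw [Filter.eventually_all]
    intro a
    by_cases ha : (box μ ν (s + 1) a).2 + 1 = μ.rowLen (box μ ν (s + 1) a).1
    · have hU : stdU μ ν (s + 1) a = 1 := by
        rw [stdU, if_pos]
        rw [hnum, add_zero, ha]
      by_cases h0 : v a = 0
      · filter_upwards [self_mem_nhdsWithin] with z hz _
        simpa [h0, hU] using hz
      · have : ∀ᶠ z : ℂ in nhds 0, v a + z ≠ 0 :=
          ContinuousAt.eventually_ne (by fun_prop) (by simpa using h0)
        filter_upwards [nhdsWithin_le_nhds this] with z hz _
        simpa [hU] using hz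
    · exact Filter.Eventually.of_forall fun z h => absurd h ha
  have hvan : ∀ᶠ z : ℂ in nhdsWithin 0 {0}ᶜ, aeval (q z) F = 0 := by
    filter_upwards [hgen] with z hz
    refine hF _ ((mem_orbit_iff hs).2 ?_)
    obtain ⟨T, T', hT, hTN, hTU⟩ := exists_commute_mulVec hs (v + z • stdU μ ν (s + 1))
      (fun a ha => by
        by_cases h0 : v a = 0
        · have : stdU μ ν (s + 1) a ≠ 0 := fun h => ha (by simp [h0, h])
          rw [stdU, Ne, ite_eq_right_iff, not_forall, hnum] at this
          obtain ⟨h1, _⟩ := this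
          omega
        · exact hsupp a h0) hz
    refine ⟨g' (s + 1) * T, T' * g (s + 1), ?_, ?_, ?_⟩
    · rw [Matrix.mul_assoc, ← Matrix.mul_assoc (g _), hg', Matrix.one_mul, hT]
    · change endOf (projPoint p) * _ = _
      rw [← Matrix.mul_assoc, hend, Matrix.mul_assoc, Matrix.mul_assoc, hTN]
    · rw [← Matrix.mulVec_mulVec, hTU]
      rfl
  have hcont : Continuous fun z => aeval (q z) F := by
    refine (continuous_eval F).comp (continuous_pi fun c => ?_)
    rcases c with a | ⟨a, b⟩
    · exact (continuous_apply a).comp (Continuous.matrix_mulVec continuous_const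
        (continuous_const.add (continuous_id.smul continuous_const)))
    · exact continuous_const
  have hlim : Filter.Tendsto (fun z => aeval (q z) F) (nhdsWithin 0 {0}ᶜ)
      (nhds (aeval (q 0) F)) := hcont.continuousAt.tendsto.mono_left nhdsWithin_le_nhds
  rw [← hq0]
  exact tendsto_nhds_unique hlim (tendsto_const_nhds.congr' (hvan.mono fun z hz => hz.symm))

/-- If the quiver variety is irreducible, then the kernel of the comorphism of the projection is the
ideal of the orbit: the points with injective `A_i` and surjective `B_i` are dense. -/
theorem mem_vanishingIdeal_orbit_iff (hs : numCols μ ν = s + 1)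
    [IsDomain (CoordinateRing (quiverVariety (colSeq μ ν) (s + 1) (colSet μ ν)))]
    (F : MvPolynomial (PairCoord (dimU (colSeq μ ν) (s + 1))) ℂ) :
    F ∈ vanishingIdeal ℂ (orbit μ ν (dimU (colSeq μ ν) (s + 1))) ↔
      toCoordinateRing (quiverVariety (colSeq μ ν) (s + 1) (colSet μ ν))
        (projHom (dimU (colSeq μ ν)) s F) = 0 := by
  set V := quiverVariety (colSeq μ ν) (s + 1) (colSet μ ν)
  constructor
  · intro hF
    let G : Fin (s + 1) → CoordinateRing V := fun i =>
      ((stdA μ ν i).transpose.map (algebraMap ℂ (CoordinateRing V)) * coordA V i i.2).det *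
      (coordB V i i.2 * (stdB μ ν i).transpose.map (algebraMap ℂ (CoordinateRing V))).det
    have hG : ∀ p i, evalPoint p (G i) =
        ((stdA μ ν i).transpose * AOf p.1 i i.2).det *
          (BOf p.1 i i.2 * (stdB μ ν i).transpose).det := by
      intro p i
      rw [map_mul, AlgHom.map_det, AlgHom.map_det]
      congr 2
      · ext a b
        simp [Matrix.mul_apply]
      · ext a b
        simp [Matrix.mul_apply]
    have hG0 : ∏ i, G i ≠ 0 := by
      rw [Finset.prod_ne_zero_iff]
      intro i _ h
      have h1 := hG ⟨stdPoint μ ν (s + 1), stdPoint_mem hs⟩ i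
      have hA : AOf (stdPoint μ ν (s + 1)) i i.2 = stdA μ ν i := rfl
      have hB : BOf (stdPoint μ ν (s + 1)) i i.2 = stdB μ ν i := rfl
      have hi : (i : ℕ) < numCols μ ν := by
        rw [hs]
        exact i.2
      rw [h, map_zero, hA, hB, transpose_mul_stdA hi, stdB_mul_transpose hi, Matrix.det_one,
        mul_one] at h1
      exact zero_ne_one h1
    refine (mul_eq_zero.1 (coordinateRing_ext fun p => ?_ : (∏ i, G i) * _ = 0)).resolve_left hG0
    rw [map_mul, map_zero, map_prod, evalPoint_toCoordinateRing, aeval_projHom]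
    by_cases h : ∃ i, evalPoint p (G i) = 0
    · obtain ⟨i, hi⟩ := h
      rw [Finset.prod_eq_zero (Finset.mem_univ i) hi, zero_mul]
    · have h1 : ∀ i (hi : i < s + 1), IsUnit ((stdA μ ν i).transpose * AOf p.1 i hi).det ∧
          IsUnit (BOf p.1 i hi * (stdB μ ν i).transpose).det := fun i hi => by
        have h2 := not_exists.1 h ⟨i, hi⟩
        rw [hG] at h2
        exact ⟨(left_ne_zero_of_mul h2).isUnit, (right_ne_zero_of_mul h2).isUnit⟩
      rw [aeval_projPoint_eq_zero hs hF p.2, mul_zero]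
      · exact fun i hi => ⟨_, (Matrix.mul_assoc _ _ _).trans (Matrix.nonsing_inv_mul _ (h1 i hi).1)⟩
      · exact fun i hi => ⟨_, (Matrix.mul_assoc _ _ _).symm.trans
          (Matrix.mul_nonsing_inv _ (h1 i hi).2)⟩
  · intro hF q hq
    obtain ⟨p, hp, rfl⟩ := exists_projPoint_eq hs hq
    rw [← aeval_projHom]
    exact toCoordinateRing_eq_zero.1 hF p hp

end Orbit

end EnhancedNilpotent

end

theorem theorem4p4 (n : ℕ) (hn : 0 < n) (μ ν : YoungDiagram) (hμν : μ.card + ν.card = n)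
    (hΛ : EnhancedNilpotent.IsNormalVariety (EnhancedNilpotent.enhancedQuiverVariety μ ν)) :
    EnhancedNilpotent.IsNormalVariety
      (EnhancedNilpotent.zariskiClosure (EnhancedNilpotent.orbit μ ν n)) := by
  obtain ⟨t, ht⟩ : ∃ t, EnhancedNilpotent.numCols μ ν = t := ⟨_, rfl⟩
  have hdim := (EnhancedNilpotent.dimU_numCols μ ν).trans hμν
  rw [EnhancedNilpotent.enhancedQuiverVariety] at hΛ
  rw [ht] at hΛ hdim
  subst hdim
  rcases t with _ | s
  · exact absurd hn (lt_irrefl 0)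
  · have := EnhancedNilpotent.isDomain_quiverVariety hΛ
    exact EnhancedNilpotent.isNormalVariety_of_ker hΛ
      (EnhancedNilpotent.mem_vanishingIdeal_orbit_iff ht)
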